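/- Let $f_0,f_1$ be probability densities on $\mathbb{R}$ (pre- and post-change) with $0<\mathbf I(f_1\|f_0)<\infty$ and $0<\mathbf I(f_0\|f_1)<\infty$, where $\mathbf I$ is the Kullback–Leibler divergence; let $\mathbb P_0,\mathbb P_1$ be the laws with these densities, and let $X_1,X_2,\dots$ be i.i.d. with density $f_0$ under $\mathbb P_\infty$. A censoring strategy is a measurable $\psi:\mathbb R\to\{0,1\}$ ($\psi(x)=1$ means that $x$ is sent). Put $$\ell^{\psi}(x)=\psi(x)\ln\frac{f_1(x)}{f_0(x)}+(1-\psi(x))\ln\frac{\mathbb P_1\{\psi=0\}}{\mathbb P_0\{\psi=0\}},\qquad \mathbf I^{\psi}(f_1\|f_0)=\int \ell^{\psi}(x)f_1(x)\,dx ,$$ (the second term of $\ell^\psi$ being taken as $0$ if $\mathbb P_0\{\psi=0\}=0$), and for $0<e\le 1$ let $\psi^*(e)$ denote a maximizer of $\mathbf I^{\psi}(f_1\|f_0)$ over all $\psi$ with $\mathbb P_0\{\psi=1\}=e$. Given $a_1>0$ and $0<\epsilon_1\le1$, define $s_0=0$ and, for $k\ge1$, $\psi_k=\psi^*(1)$ if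 $s_{k-1}\ge a_1$ and $\psi_k=\psi^*(\epsilon_1)$ if $s_{k-1}<a_1$, $\gamma_k=\psi_k(X_k)$, $\tilde s_k=\max\{0,s_{k-1}+\ell^{\psi_k}(X_k)\}$, and $s_k=a_1$ if $s_{k-1}<a_1\le\tilde s_k$, $s_k=\tilde s_k$ otherwise. For $a\in(a_1,\infty]$ let $T_c(a)=\inf\{k:s_k\ge a\}$ (with $\inf\emptyset=\infty$, so $T_c(\infty)=\infty$), and let the communication rate be $$r(\Psi)=\limsup_{n\to\infty}\frac1n\,\mathbb E_\infty\Big[\sum_{k=1}^n\gamma_k\,\Big|\,T_c(a)\ge n\Big].$$ Then for every finite $a_1>0$ and every $0<\epsilon\le1$ there is a non-empty set $\mathcal E(a_1,\epsilon)\subseteq(0,1]$, not depending on $a$, such that for every $\epsilon_1\in\mathcal E(a_1,\epsilon)$ the maximizers $\psi^*(\epsilon_1)$ and $\psi^*(1)$ exist and, for every choice of them, $\mathbb P_\infty\{T_c(a)\ge n\}>0$ for all $n$ and $$r(\Psi)\le\epsilon\qquad\text{for all } a\in(a_1,+\infty].$$ -/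

import Mathlib

open MeasureTheory ProbabilityTheory Filter

noncomputable section

namespace CuSumAC

/-- `f` is a probability density function on `ℝ` (with respect to Lebesgue measure). -/
structure IsDensity (f : ℝ → ℝ) : Prop where
  measurable : Measurable f
  nonneg : ∀ x, 0 ≤ f x
  lintegral_eq_one : ∫⁻ x, ENNReal.ofReal (f x) = 1

/-- The law on `ℝ` with density `f`. -/
def law (f : ℝ → ℝ) : Measure ℝ :=
  volume.withDensity fun x => ENNReal.ofReal (f x)

/-- A censoring strategy `ψ : ℝ → {0, 1}`: the sensor sends the observation `x` iff
`ψ x = true`. -/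
abbrev Strategy : Type := ℝ → Bool

/-- The transmission indicator `γ = ψ x`, as a real number in `{0, 1}`. -/
def sent (ψ : Strategy) (x : ℝ) : ℝ := if ψ x = true then 1 else 0

/-- The probability `ℙ{γ = 0 | ψ}` that nothing is sent, for an observation with density `f`. -/
def probNoSend (f : ℝ → ℝ) (ψ : Strategy) : ℝ := (law f).real {x | ψ x = false}

/-- The log-likelihood ratio `ℓ^ψ(γ, x)` of the censored observation, where `γ = ψ x`. -/
def llrCensored (f₀ f₁ : ℝ → ℝ) (ψ : Strategy) (x : ℝ) : ℝ :=
  Real.log (f₁ x / f₀ x) * sent ψ x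
    + Real.log (probNoSend f₁ ψ / probNoSend f₀ ψ) * (1 - sent ψ x)

/-- The post-censoring Kullback–Leibler divergence `I^ψ(f₁ ‖ f₀) = 𝔼₁[ℓ^ψ(γ₁, X₁)]`. -/
def infoCensored (f₀ f₁ : ℝ → ℝ) (ψ : Strategy) : ℝ :=
  ∫ x, llrCensored f₀ f₁ ψ x ∂(law f₁)

/-- The class `𝒞(e)` of (measurable) censoring strategies whose pre-change probability of sending
is exactly `e`. -/
def strategyClass (f₀ : ℝ → ℝ) (e : ℝ) : Set Strategy :=
  {ψ | Measurable ψ ∧ (law f₀).real {x | ψ x = true} = e}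

/-- `ψ` is a maximizer `ψ*(e)` of `I^ψ(f₁ ‖ f₀)` over `𝒞(e)`. -/
def IsOptimal (f₀ f₁ : ℝ → ℝ) (e : ℝ) (ψ : Strategy) : Prop :=
  ψ ∈ strategyClass f₀ e ∧ IsMaxOn (infoCensored f₀ f₁) (strategyClass f₀ e) ψ

/-- The strategy used at the next time instant when the current statistic is `s`:
`ψtop` (in the role of `ψ*(1)`) if `s ≥ a₁`, and `ψlow` (in the role of `ψ*(ε₁)`) if `s < a₁`. -/
def policy (a₁ : ℝ) (ψtop ψlow : Strategy) (s : ℝ) : Strategy :=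
  if a₁ ≤ s then ψtop else ψlow

/-- The uncorrected update `s̃ = max {0, s + ℓ^ψ(γ, x)}` from the statistic `s`, with new
observation `x`. -/
def preUpdate (f₀ f₁ : ℝ → ℝ) (a₁ : ℝ) (ψtop ψlow : Strategy) (s x : ℝ) : ℝ :=
  max 0 (s + llrCensored f₀ f₁ (policy a₁ ψtop ψlow s) x)

/-- The update of the statistic: it is reset to `a₁` whenever it reaches `a₁` from below. -/
def update (f₀ f₁ : ℝ → ℝ) (a₁ : ℝ) (ψtop ψlow : Strategy) (s x : ℝ) : ℝ :=
  if s < a₁ ∧ a₁ ≤ preUpdate f₀ f₁ a₁ ψtop ψlow s x then a₁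
  else preUpdate f₀ f₁ a₁ ψtop ψlow s x

/-- The detection statistic `s_k` along the observations `x`, with `s_0 = 0`.
Observations are indexed from zero: `x k` is the observation taken at time `k + 1`. -/
def stat (f₀ f₁ : ℝ → ℝ) (a₁ : ℝ) (ψtop ψlow : Strategy) (x : ℕ → ℝ) : ℕ → ℝ
  | 0 => 0
  | k + 1 => update f₀ f₁ a₁ ψtop ψlow (stat f₀ f₁ a₁ ψtop ψlow x k) (x k)

/-- The transmission indicator `γ_{k+1} = ψ_{k+1}(X_{k+1})`. -/
def gamma (f₀ f₁ : ℝ → ℝ) (a₁ : ℝ) (ψtop ψlow : Strategy) (x : ℕ → ℝ) (k : ℕ) : ℝ :=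
  sent (policy a₁ ψtop ψlow (stat f₀ f₁ a₁ ψtop ψlow x k)) (x k)

/-- The stopping time `T_c(a) = inf {k : s_k ≥ a}` (`⊤` if there is no such `k`); the threshold
`a = ⊤` is allowed. -/
def stopTime (f₀ f₁ : ℝ → ℝ) (a₁ : ℝ) (ψtop ψlow : Strategy) (a : EReal) (x : ℕ → ℝ) : ℕ∞ :=
  ⨅ (k : ℕ) (_ : a ≤ (stat f₀ f₁ a₁ ψtop ψlow x k : EReal)), (k : ℕ∞)

/-- The event `{T_c(a) ≥ n}`. -/
def survival {Ω : Type*} (X : ℕ → Ω → ℝ) (f₀ f₁ : ℝ → ℝ) (a₁ : ℝ) (ψtop ψlow : Strategy)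
    (a : EReal) (n : ℕ) : Set Ω :=
  {ω | (n : ℕ∞) ≤ stopTime f₀ f₁ a₁ ψtop ψlow a fun k => X k ω}

/-- The communication rate
`r(Ψ) = limsup_{n → ∞} (1/n) 𝔼[γ_1 + ⋯ + γ_n | T_c(a) ≥ n]` under the measure `P`. -/
def commRate {Ω : Type*} [MeasurableSpace Ω] (P : Measure Ω) (X : ℕ → Ω → ℝ)
    (f₀ f₁ : ℝ → ℝ) (a₁ : ℝ) (ψtop ψlow : Strategy) (a : EReal) : ℝ :=
  limsup (fun n : ℕ => (1 / (n : ℝ)) *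
    ∫ ω, ∑ k ∈ Finset.range n, gamma f₀ f₁ a₁ ψtop ψlow (fun j => X j ω) k
      ∂(ProbabilityTheory.cond P (survival X f₀ f₁ a₁ ψtop ψlow a n))) atTop

end CuSumAC

end

noncomputable section

namespace CuSumAC

/-! ### Laws with densities -/

/-! Let `S` be the number of transmissions up to time `n`. If `E exp (θ S) ≤ C ^ n`, the survival
event has probability at least `κ ^ n`, and `C ≤ exp (θ ε) κ`, then the conditional mean of `S` is
at most `n ε` (`integral_cond_le`). It is therefore enough to fix `θ > 0` and to find such `C` and
`κ` that both tend to `1` as the transmission probability `e` of `ψ*(ε₁)` tends to `0`. The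
admissible set is then an interval `(0, δ]`.

Below `a₁` a transmission has probability `e`, a silent step raises the statistic by at most `-log
(1 - e)`, and the reset prevents overshoot of `a₁`. From `a₁` on almost every observation is sent.
Excursions above `a₁` are nevertheless short: under `f₀` the mean `β` of `exp (L / 2)`, with `L` the
log-likelihood ratio, is the Hellinger affinity, and `β < 1`. From `a₁` itself the mean drop,
truncated at `a₁` and divided by `a₁`, is some `g > 0`.

Two test functions turn this into one-step inequalities for the Markov chain of the statistic.
`superSol` grows linearly from `1` to `2` on `[0, a₁]` and exponentially above; it yields `C`
(`lintegral_superSol_le`). `subSol` falls linearly to `1 - c` at `a₁` and vanishes above; it yields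
`κ` (`le_lintegral_subSol`) as a bound for never exceeding `a₁`, an event contained in every
survival event with `a > a₁`. Since `θ` depends only on `β` and `g`, `e` can be made small
afterwards, uniformly in `a`.

A maximizer `ψ*(e)` exists because the information loss of a silent region is an integral plus a
concave function of its `f₁`-mass. Writing that function as a minimum of affine ones leaves a family
of bathtub problems and a one-parameter minimization over a compact interval
(`exists_minimal_information_loss`). -/

lemma IsDensity.isProbabilityMeasure_law {f : ℝ → ℝ} (hf : IsDensity f) :
    IsProbabilityMeasure (law f) :=
  ⟨by rw [law, withDensity_apply _ MeasurableSet.univ, setLIntegral_univ, hf.lintegral_eq_one]⟩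

instance nullSingletonClass_law (f : ℝ → ℝ) : NullSingletonClass (law f) :=
  ⟨fun x => withDensity_absolutelyContinuous _ _ (measure_singleton x)⟩

lemma ae_law_pos {f : ℝ → ℝ} (hf : IsDensity f) : ∀ᵐ x ∂(law f), 0 < f x := by
  rw [law, ae_withDensity_iff hf.measurable.ennreal_ofReal]
  filter_upwards with x hx
  simpa using hx

/-- If `law f₁` is absolutely continuous with respect to `law f₀`, then `f₁` vanishes almost
everywhere on the zero set of `f₀`. -/
lemma ae_eq_zero_of_law_absolutelyContinuous {f₀ f₁ : ℝ → ℝ} (hf₀ : IsDensity f₀)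
    (hf₁ : IsDensity f₁) (h : law f₁ ≪ law f₀) : ∀ᵐ x, f₀ x = 0 → f₁ x = 0 := by
  have h1 : ∀ᵐ x ∂(law f₁), 0 < f₀ x := h.ae_le (ae_law_pos hf₀)
  rw [law, ae_withDensity_iff hf₁.measurable.ennreal_ofReal] at h1
  filter_upwards [h1] with x hx h0
  by_contra hne
  have hpos : 0 < f₁ x := lt_of_le_of_ne (hf₁.nonneg x) (Ne.symm hne)
  have := hx (by simpa using hpos)
  exact absurd h0 this.ne'

lemma law_eq_withDensity {f₀ f₁ : ℝ → ℝ} (hf₀ : IsDensity f₀) (hf₁ : IsDensity f₁)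
    (h : law f₁ ≪ law f₀) :
    law f₁ = (law f₀).withDensity fun x => ENNReal.ofReal (f₁ x / f₀ x) := by
  have hm : Measurable fun x => ENNReal.ofReal (f₁ x / f₀ x) :=
    (hf₁.measurable.div hf₀.measurable).ennreal_ofReal
  rw [law, law, ← withDensity_mul _ hf₀.measurable.ennreal_ofReal hm]
  refine withDensity_congr_ae ?_
  filter_upwards [ae_eq_zero_of_law_absolutelyContinuous hf₀ hf₁ h] with x hx
  rw [Pi.mul_apply, ← ENNReal.ofReal_mul (hf₀.nonneg x)]
  by_cases h0 : f₀ x = 0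
  · rw [hx h0, h0]; simp
  · rw [mul_div_cancel₀ _ h0]

lemma ae_ratio_pos {f₀ f₁ : ℝ → ℝ} (hf₀ : IsDensity f₀) (hf₁ : IsDensity f₁)
    (h : law f₀ ≪ law f₁) : ∀ᵐ x ∂(law f₀), 0 < f₁ x / f₀ x := by
  filter_upwards [ae_law_pos hf₀, h.ae_le (ae_law_pos hf₁)] with x h0 h1
  exact div_pos h1 h0

lemma lintegral_ratio {f₀ f₁ : ℝ → ℝ} (hf₀ : IsDensity f₀) (hf₁ : IsDensity f₁)
    (h : law f₁ ≪ law f₀) : ∫⁻ x, ENNReal.ofReal (f₁ x / f₀ x) ∂(law f₀) = 1 := by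
  have := hf₁.isProbabilityMeasure_law
  have h1 := measure_univ (μ := law f₁)
  rwa [law_eq_withDensity hf₀ hf₁ h, withDensity_apply _ MeasurableSet.univ,
    setLIntegral_univ] at h1

lemma ratio_nonneg {f₀ f₁ : ℝ → ℝ} (hf₀ : IsDensity f₀) (hf₁ : IsDensity f₁) (x : ℝ) :
    0 ≤ f₁ x / f₀ x := div_nonneg (hf₁.nonneg x) (hf₀.nonneg x)

lemma integrable_ratio {f₀ f₁ : ℝ → ℝ} (hf₀ : IsDensity f₀) (hf₁ : IsDensity f₁)
    (h : law f₁ ≪ law f₀) : Integrable (fun x => f₁ x / f₀ x) (law f₀) := by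
  refine ⟨(hf₁.measurable.div hf₀.measurable).aestronglyMeasurable, ?_⟩
  rw [hasFiniteIntegral_iff_ofReal (ae_of_all _ (ratio_nonneg hf₀ hf₁)),
    lintegral_ratio hf₀ hf₁ h]
  exact ENNReal.one_lt_top

lemma integral_ratio {f₀ f₁ : ℝ → ℝ} (hf₀ : IsDensity f₀) (hf₁ : IsDensity f₁)
    (h : law f₁ ≪ law f₀) : ∫ x, f₁ x / f₀ x ∂(law f₀) = 1 := by
  rw [integral_eq_lintegral_of_nonneg_ae (ae_of_all _ (ratio_nonneg hf₀ hf₁))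
    (hf₁.measurable.div hf₀.measurable).aestronglyMeasurable, lintegral_ratio hf₀ hf₁ h]
  rfl

/-- The equality case behind both strict inequalities, `β < 1` and `g > 0`. -/
lemma law_eq_of_ae_ratio_eq_one {f₀ f₁ : ℝ → ℝ} (hf₀ : IsDensity f₀) (hf₁ : IsDensity f₁)
    (h : law f₁ ≪ law f₀) (h1 : ∀ᵐ x ∂(law f₀), f₁ x / f₀ x = 1) : law f₁ = law f₀ := by
  rw [law_eq_withDensity hf₀ hf₁ h]
  conv_rhs => rw [← withDensity_one (μ := law f₀)]
  refine withDensity_congr_ae ?_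
  filter_upwards [h1] with x hx
  simp [hx]

/-- The log-likelihood ratio is integrable under `law f₁` when the divergence is finite. -/
lemma integrable_log_ratio {f₀ f₁ : ℝ → ℝ} (hf₀ : IsDensity f₀) (hf₁ : IsDensity f₁)
    (h : law f₁ ≪ law f₀) (hllr : Integrable (llr (law f₁) (law f₀)) (law f₁)) :
    Integrable (fun x => Real.log (f₁ x / f₀ x)) (law f₁) := by
  have := hf₀.isProbabilityMeasure_law
  refine hllr.congr (h.ae_le ?_)
  have h2 := (law f₀).rnDeriv_withDensity
    (hf₁.measurable.div hf₀.measurable).ennreal_ofReal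
  have h3 : (law f₁).rnDeriv (law f₀) =ᵐ[law f₀] fun x => ENNReal.ofReal (f₁ x / f₀ x) := by
    conv_lhs => rw [law_eq_withDensity hf₀ hf₁ h]
    exact h2
  filter_upwards [h3] with x hx
  rw [llr, hx, ENNReal.toReal_ofReal (ratio_nonneg hf₀ hf₁ x)]

/-! ### Hellinger affinity and mean drop of the log-likelihood ratio -/

/-- The arithmetic-geometric mean inequality for `1` and `r`, strict off the diagonal. -/
lemma exp_half_log_lt {r : ℝ} (hr : 0 < r) (h1 : r ≠ 1) :
    Real.exp (Real.log r / 2) < (1 + r) / 2 := by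
  rw [Real.exp_half, Real.exp_log hr]
  have h2 : Real.sqrt r ≠ 1 := by
    intro h
    exact h1 (by rw [← Real.sq_sqrt hr.le, h]; norm_num)
  have h3 : 0 < (Real.sqrt r - 1) ^ 2 := by
    have : Real.sqrt r - 1 ≠ 0 := sub_ne_zero.2 h2
    positivity
  nlinarith [Real.sq_sqrt hr.le]

lemma exp_half_log_le {r : ℝ} (hr : 0 < r) :
    Real.exp (Real.log r / 2) ≤ (1 + r) / 2 := by
  by_cases h1 : r = 1
  · simp [h1]
  · exact (exp_half_log_lt hr h1).le

lemma measurable_log_ratio {f₀ f₁ : ℝ → ℝ} (hf₀ : IsDensity f₀) (hf₁ : IsDensity f₁) :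
    Measurable fun x => Real.log (f₁ x / f₀ x) :=
  Real.measurable_log.comp (hf₁.measurable.div hf₀.measurable)

lemma integrable_exp_half {f₀ f₁ : ℝ → ℝ} (hf₀ : IsDensity f₀) (hf₁ : IsDensity f₁)
    (h10 : law f₁ ≪ law f₀) (h01 : law f₀ ≪ law f₁) :
    Integrable (fun x => Real.exp (Real.log (f₁ x / f₀ x) / 2)) (law f₀) := by
  have := hf₀.isProbabilityMeasure_law
  refine (((integrable_const (1 : ℝ)).add (integrable_ratio hf₀ hf₁ h10)).div_const 2).mono'
    (((measurable_log_ratio hf₀ hf₁).div_const 2).exp).aestronglyMeasurable ?_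
  filter_upwards [ae_ratio_pos hf₀ hf₁ h01] with x hx
  rw [Real.norm_of_nonneg (Real.exp_pos _).le]
  exact exp_half_log_le hx

/-- The Hellinger affinity of two different laws is strictly less than one. -/
lemma integral_exp_half_lt_one {f₀ f₁ : ℝ → ℝ} (hf₀ : IsDensity f₀) (hf₁ : IsDensity f₁)
    (h10 : law f₁ ≪ law f₀) (h01 : law f₀ ≪ law f₁) (hne : law f₁ ≠ law f₀) :
    ∫ x, Real.exp (Real.log (f₁ x / f₀ x) / 2) ∂(law f₀) < 1 := by
  have := hf₀.isProbabilityMeasure_law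
  have hpos := ae_ratio_pos hf₀ hf₁ h01
  have hi1 := integrable_exp_half hf₀ hf₁ h10 h01
  have hi2 : Integrable (fun x => (1 + f₁ x / f₀ x) / 2) (law f₀) :=
    ((integrable_const (1 : ℝ)).add (integrable_ratio hf₀ hf₁ h10)).div_const 2
  have hval : ∫ x, (1 + f₁ x / f₀ x) / 2 ∂(law f₀) = 1 := by
    rw [integral_div, integral_add (integrable_const _) (integrable_ratio hf₀ hf₁ h10),
      integral_ratio hf₀ hf₁ h10]
    simp
  have hle : (fun x => Real.exp (Real.log (f₁ x / f₀ x) / 2)) ≤ᵐ[law f₀]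
      fun x => (1 + f₁ x / f₀ x) / 2 := by
    filter_upwards [hpos] with x hx using exp_half_log_le hx
  refine lt_of_le_of_ne (hval ▸ integral_mono_ae hi1 hi2 hle) fun heq => hne ?_
  refine law_eq_of_ae_ratio_eq_one hf₀ hf₁ h10 ?_
  have h2 := (integral_eq_iff_of_ae_le hi1 hi2 hle).1 (heq.trans hval.symm)
  filter_upwards [h2, hpos] with x hx hp
  by_contra h1
  exact (exp_half_log_lt hp h1).ne hx

/-- The mean of the truncated negative part of the log-likelihood ratio is positive. -/
lemma integral_min_neg_log_pos {f₀ f₁ : ℝ → ℝ} (hf₀ : IsDensity f₀) (hf₁ : IsDensity f₁)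
    (h10 : law f₁ ≪ law f₀) (h01 : law f₀ ≪ law f₁) (hne : law f₁ ≠ law f₀)
    {a : ℝ} (ha : 0 < a) :
    0 < ∫ x, min 1 (max 0 (-Real.log (f₁ x / f₀ x)) / a) ∂(law f₀) := by
  have := hf₀.isProbabilityMeasure_law
  have hnn : ∀ x, 0 ≤ min 1 (max 0 (-Real.log (f₁ x / f₀ x)) / a) := fun x => by positivity
  have hint : Integrable (fun x => min 1 (max 0 (-Real.log (f₁ x / f₀ x)) / a)) (law f₀) := by
    refine (integrable_const (1 : ℝ)).mono' ?_ (ae_of_all _ fun x => ?_)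
    · exact (measurable_const.min ((measurable_const.max
        (measurable_log_ratio hf₀ hf₁).neg).div_const a)).aestronglyMeasurable
    · rw [Real.norm_of_nonneg (hnn x)]
      exact min_le_left _ _
  refine lt_of_le_of_ne (integral_nonneg hnn) fun heq => hne ?_
  have h0 := (integral_eq_zero_iff_of_nonneg hnn hint).1 heq.symm
  have hpos := ae_ratio_pos hf₀ hf₁ h01
  -- Without a negative part the ratio is at least `1`; as its mean is `1`, it equals `1` almost
  -- everywhere.
  have hle : (fun _ => (1 : ℝ)) ≤ᵐ[law f₀] fun x => f₁ x / f₀ x := by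
    filter_upwards [h0, hpos] with x hx hp
    by_contra hlt
    have h1 : Real.log (f₁ x / f₀ x) < 0 := Real.log_neg hp (not_le.1 hlt)
    have h2 : 0 < min 1 (max 0 (-Real.log (f₁ x / f₀ x)) / a) :=
      lt_min one_pos (div_pos (lt_max_of_lt_right (by linarith)) ha)
    exact h2.ne' hx
  refine law_eq_of_ae_ratio_eq_one hf₀ hf₁ h10 ?_
  have h2 := (integral_eq_iff_of_ae_le (integrable_const (1 : ℝ))
    (integrable_ratio hf₀ hf₁ h10) hle).1 (by simp [integral_ratio hf₀ hf₁ h10])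
  filter_upwards [h2] with x hx using hx.symm

/-! ### A bathtub principle -/

lemma tendsto_measure_Iic_neg_nat (m : Measure ℝ) [IsFiniteMeasure m] :
    Tendsto (fun n : ℕ => m (Set.Iic (-(n : ℝ)))) atTop (nhds 0) := by
  have h := tendsto_measure_iInter_atTop (μ := m) (s := fun n : ℕ => Set.Iic (-(n : ℝ)))
    (fun n => measurableSet_Iic.nullMeasurableSet)
    (fun i j hij => Set.Iic_subset_Iic.2 (neg_le_neg (Nat.cast_le.2 hij)))
    ⟨0, measure_ne_top _ _⟩
  have h0 : (⋂ n : ℕ, Set.Iic (-(n : ℝ))) = ∅ := by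
    ext x
    simp only [Set.mem_iInter, Set.mem_Iic, Set.mem_empty_iff_false, iff_false, not_forall, not_le]
    obtain ⟨n, hn⟩ := exists_nat_gt (-x)
    exact ⟨n, by linarith⟩
  rw [h0, measure_empty] at h
  exact h

/-- A finite measure on the line has quantiles of every level strictly between zero and the total
mass. -/
lemma exists_quantile (m : Measure ℝ) [IsFiniteMeasure m] {c : ENNReal} (h0 : 0 < c)
    (h1 : c < m Set.univ) : ∃ τ, m (Set.Iio τ) ≤ c ∧ c ≤ m (Set.Iic τ) := by
  -- The quantile is `sInf S`; the two bounds are continuity of the measure from below and from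
  -- above there.
  set S : Set ℝ := {t | c ≤ m (Set.Iic t)}
  have hup : ∀ s t, s ≤ t → s ∈ S → t ∈ S := fun s t hst hs =>
    le_trans (Set.mem_ofPred.1 hs) (measure_mono (Set.Iic_subset_Iic.2 hst))
  have hne : S.Nonempty := by
    obtain ⟨t, ht⟩ := ((tendsto_measure_Iic_atTop m).eventually (lt_mem_nhds h1)).exists
    exact ⟨t, ht.le⟩
  have hbdd : BddBelow S := by
    obtain ⟨n, hn⟩ := ((tendsto_measure_Iic_neg_nat m).eventually (gt_mem_nhds h0)).exists
    refine ⟨-(n : ℝ), fun t ht => ?_⟩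
    by_contra hlt
    exact not_le.2 hn (Set.mem_ofPred.1 (hup t _ (not_le.1 hlt).le ht))
  have hε : ∀ n : ℕ, (0 : ℝ) < 1 / ((n : ℝ) + 1) := fun n => by positivity
  refine ⟨sInf S, ?_, ?_⟩
  · have hU : Set.Iio (sInf S) = ⋃ n : ℕ, Set.Iic (sInf S - 1 / ((n : ℝ) + 1)) := by
      ext x
      simp only [Set.mem_Iio, Set.mem_iUnion, Set.mem_Iic]
      constructor
      · intro hx
        obtain ⟨n, hn⟩ := exists_nat_one_div_lt (sub_pos.2 hx)
        exact ⟨n, by linarith⟩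
      · rintro ⟨n, hn⟩
        linarith [hε n]
    have hmono : Monotone fun n : ℕ => Set.Iic (sInf S - 1 / ((n : ℝ) + 1)) := by
      intro i j hij
      refine Set.Iic_subset_Iic.2 (sub_le_sub_left ?_ _)
      exact Nat.one_div_le_one_div hij
    rw [hU]
    refine le_of_tendsto' (tendsto_measure_iUnion_atTop hmono) fun n => ?_
    by_contra hlt
    have : sInf S ≤ sInf S - 1 / ((n : ℝ) + 1) := csInf_le hbdd (not_le.1 hlt).le
    linarith [hε n]
  · have hI : Set.Iic (sInf S) = ⋂ n : ℕ, Set.Iic (sInf S + 1 / ((n : ℝ) + 1)) := by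
      ext x
      simp only [Set.mem_Iic, Set.mem_iInter]
      constructor
      · intro hx n
        linarith [hε n]
      · intro hx
        by_contra hlt
        obtain ⟨n, hn⟩ := exists_nat_one_div_lt (sub_pos.2 (not_le.1 hlt))
        linarith [hx n]
    have hanti : Antitone fun n : ℕ => Set.Iic (sInf S + 1 / ((n : ℝ) + 1)) := by
      intro i j hij
      refine Set.Iic_subset_Iic.2 (add_le_add_right ?_ _)
      exact Nat.one_div_le_one_div hij
    rw [hI]
    refine ge_of_tendsto' (tendsto_measure_iInter_atTop
      (fun n => measurableSet_Iic.nullMeasurableSet) hanti ⟨0, measure_ne_top _ _⟩) fun n => ?_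
    obtain ⟨t, htS, ht⟩ := exists_lt_of_csInf_lt hne
      (show sInf S < sInf S + 1 / ((n : ℝ) + 1) by linarith [hε n])
    exact hup _ _ ht.le htS

/-- A diffuse measure on the line takes all intermediate values on subsets of a given set. -/
lemma exists_subset_measure_eq (μ : Measure ℝ) [IsFiniteMeasure μ] [NullSingletonClass μ]
    {T : Set ℝ} (hT : MeasurableSet T) {c : ENNReal} (hc : c ≤ μ T) :
    ∃ U ⊆ T, MeasurableSet U ∧ μ U = c := by
  rcases eq_or_ne c 0 with rfl | h0
  · exact ⟨∅, Set.empty_subset _, MeasurableSet.empty, measure_empty⟩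
  rcases eq_or_lt_of_le hc with rfl | hlt
  · exact ⟨T, subset_rfl, hT, rfl⟩
  obtain ⟨τ, h1, h2⟩ := exists_quantile (μ.restrict T) (pos_iff_ne_zero.2 h0)
    (by rwa [Measure.restrict_apply_univ])
  refine ⟨Set.Iic τ ∩ T, Set.inter_subset_right, measurableSet_Iic.inter hT, ?_⟩
  rw [Measure.restrict_apply measurableSet_Iio] at h1
  rw [Measure.restrict_apply measurableSet_Iic] at h2
  refine le_antisymm (le_trans ?_ h1) h2
  -- The two half-lines differ by the null point `τ`.
  refine measure_mono_ae ?_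
  filter_upwards [compl_mem_ae_iff.2 (measure_singleton (μ := μ) τ)] with x hx hxT
  exact ⟨lt_of_le_of_ne hxT.1 hx, hxT.2⟩

/-- Bathtub principle: among the sets of a given mass for a diffuse probability measure on the
line, one minimizes the integral of a given function. -/
lemma exists_minimal_setIntegral (μ : Measure ℝ) [IsProbabilityMeasure μ] [NullSingletonClass μ]
    {h : ℝ → ℝ} (hm : Measurable h) (hi : Integrable h μ) {c : ℝ} (hc0 : 0 < c) (hc1 : c < 1) :
    ∃ A, MeasurableSet A ∧ μ.real A = c ∧
      ∀ B, MeasurableSet B → μ.real B = c → ∫ x in A, h x ∂μ ≤ ∫ x in B, h x ∂μ := by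
  have := Measure.isProbabilityMeasure_map (μ := μ) hm.aemeasurable
  obtain ⟨τ, h1, h2⟩ := exists_quantile (μ.map h) (c := ENNReal.ofReal c)
    (ENNReal.ofReal_pos.2 hc0) (by rw [measure_univ]; exact ENNReal.ofReal_lt_one.2 hc1)
  rw [Measure.map_apply hm measurableSet_Iio] at h1
  rw [Measure.map_apply hm measurableSet_Iic] at h2
  have hdiff : h ⁻¹' Set.Iic τ = h ⁻¹' Set.Iio τ ∪ h ⁻¹' {τ} := by
    rw [← Set.preimage_union]
    congr 1
    ext x
    simp [le_iff_lt_or_eq]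
  have hlev : MeasurableSet (h ⁻¹' {τ}) := hm (measurableSet_singleton τ)
  -- The level set `{h = τ}` may have positive mass; only the part needed to reach mass exactly `c`
  -- is kept.
  obtain ⟨U, hUs, hUm, hU⟩ := exists_subset_measure_eq μ hlev
    (c := ENNReal.ofReal c - μ (h ⁻¹' Set.Iio τ))
    (by
      rw [tsub_le_iff_left]
      refine h2.trans ?_
      rw [hdiff]
      exact measure_union_le _ _)
  have hlow : MeasurableSet (h ⁻¹' Set.Iio τ) := hm measurableSet_Iio
  have hdisj : Disjoint (h ⁻¹' Set.Iio τ) U := by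
    refine Set.disjoint_left.2 fun x hx hxU => ?_
    have h3 : h x < τ := hx
    have h4 : h x = τ := hUs hxU
    exact h3.ne h4
  refine ⟨h ⁻¹' Set.Iio τ ∪ U, hlow.union hUm, ?_, fun B hB hBc => ?_⟩
  · rw [measureReal_def, measure_union hdisj hUm, hU, add_tsub_cancel_of_le h1,
      ENNReal.toReal_ofReal hc0.le]
  · set A := h ⁻¹' Set.Iio τ ∪ U with hAdef
    have hA : MeasurableSet A := hlow.union hUm
    have hAc : μ.real A = c := by
      rw [measureReal_def, measure_union hdisj hUm, hU, add_tsub_cancel_of_le h1,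
        ENNReal.toReal_ofReal hc0.le]
    -- Subtracting `τ` shifts both integrals by `τ c`, and then `A` contains all points where the
    -- integrand is negative and none where it is positive.
    have key : ∫ x in A, (h x - τ) ∂μ ≤ ∫ x in B, (h x - τ) ∂μ := by
      rw [← integral_indicator hA, ← integral_indicator hB]
      have hi' : Integrable (fun x => h x - τ) μ := hi.sub (integrable_const _)
      refine integral_mono (hi'.indicator hA) (hi'.indicator hB) fun x => ?_
      by_cases hxA : x ∈ A
      · have hle : h x ≤ τ := by
          rcases hxA with hx | hx
          · exact le_of_lt hx
          · exact le_of_eq (hUs hx)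
        by_cases hxB : x ∈ B
        · simp [hxA, hxB]
        · simp [hxA, hxB, hle]
      · have hle : τ ≤ h x := by
          by_contra hlt
          exact hxA (Or.inl (not_le.1 hlt))
        by_cases hxB : x ∈ B
        · simp [hxA, hxB, hle]
        · simp [hxA, hxB]
    rw [integral_sub hi.integrableOn (integrable_const _),
      integral_sub hi.integrableOn (integrable_const _), setIntegral_const, setIntegral_const,
      hAc, hBc] at key
    linarith

/-! ### Existence of optimal censoring regions -/

/-- Bathtub principle for the integral with respect to a second measure having a density. -/
lemma exists_minimal_setIntegral_withDensity (μ : Measure ℝ) [IsProbabilityMeasure μ]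
    [NullSingletonClass μ] {ρ G : ℝ → ℝ} (hρ : Measurable ρ) (hρ0 : ∀ x, 0 ≤ ρ x)
    (hG : Measurable G) (hi : Integrable G (μ.withDensity fun x => ENNReal.ofReal (ρ x)))
    {c : ℝ} (hc0 : 0 < c) (hc1 : c < 1) :
    ∃ A, MeasurableSet A ∧ μ.real A = c ∧ ∀ B, MeasurableSet B → μ.real B = c →
      ∫ x in A, G x ∂(μ.withDensity fun x => ENNReal.ofReal (ρ x)) ≤
        ∫ x in B, G x ∂(μ.withDensity fun x => ENNReal.ofReal (ρ x)) := by
  have hset : ∀ B, MeasurableSet B →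
      ∫ x in B, G x ∂(μ.withDensity fun x => ENNReal.ofReal (ρ x)) = ∫ x in B, ρ x * G x ∂μ := by
    intro B hB
    rw [show (fun x => ENNReal.ofReal (ρ x)) = fun x => ((ρ x).toNNReal : ENNReal) from rfl,
      setIntegral_withDensity_eq_setIntegral_smul hρ.real_toNNReal _ hB]
    simp only [NNReal.smul_def, smul_eq_mul, Real.coe_toNNReal _ (hρ0 _)]
  have hi' : Integrable (fun x => ρ x * G x) μ := by
    rw [integrable_withDensity_iff_integrable_smul' hρ.ennreal_ofReal
      (ae_of_all _ fun x => ENNReal.ofReal_lt_top)] at hi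
    simpa only [smul_eq_mul, ENNReal.toReal_ofReal (hρ0 _)] using hi
  obtain ⟨A, hA, hAc, hmin⟩ := exists_minimal_setIntegral μ (hρ.mul hG) hi' hc0 hc1
  refine ⟨A, hA, hAc, fun B hB hBc => ?_⟩
  rw [hset A hA, hset B hB]
  exact hmin B hB hBc

/-- The affine majorant, with parameter `t`, of the concave function `x ↦ -x log (x / c)`. -/
lemma neg_mul_log_div_le {c x : ℝ} (hc : 0 < c) (hx : 0 < x) (t : ℝ) :
    -(x * Real.log (x / c)) ≤ -((1 + t) * x) + c * Real.exp t := by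
  have h := Real.log_le_sub_one_of_pos (show 0 < c * Real.exp t / x by positivity)
  rw [Real.log_div (by positivity) hx.ne', Real.log_mul hc.ne' (Real.exp_pos t).ne',
    Real.log_exp] at h
  rw [Real.log_div hx.ne' hc.ne']
  have h2 : x * (c * Real.exp t / x - 1) = c * Real.exp t - x := by field_simp
  nlinarith [mul_le_mul_of_nonneg_left h hx.le]

/-- The affine majorant touches the concave function at `t = log (x / c)`, so that function is a
minimum of its majorants. -/
lemma neg_mul_log_div_eq {c x : ℝ} (hc : 0 < c) (hx : 0 < x) :
    -((1 + Real.log (x / c)) * x) + c * Real.exp (Real.log (x / c)) = -(x * Real.log (x / c)) := by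
  rw [Real.exp_log (by positivity), mul_div_cancel₀ _ hc.ne']
  ring

/-- Among the regions of mass `c` under `μ`, one minimizes the information lost by merging the
whole region into a single symbol. -/
lemma exists_minimal_information_loss (μ ν : Measure ℝ) [IsProbabilityMeasure μ]
    [IsProbabilityMeasure ν] [NullSingletonClass μ] {ρ L : ℝ → ℝ} (hρ : Measurable ρ)
    (hρ0 : ∀ x, 0 ≤ ρ x) (hν : ν = μ.withDensity fun x => ENNReal.ofReal (ρ x)) (hμν : μ ≪ ν)
    (hL : Measurable L) (hLi : Integrable L ν) {c : ℝ} (hc0 : 0 < c) (hc1 : c < 1) :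
    ∃ A, MeasurableSet A ∧ μ.real A = c ∧ ∀ B, MeasurableSet B → μ.real B = c →
      ∫ x in A, L x ∂ν - ν.real A * Real.log (ν.real A / c) ≤
        ∫ x in B, L x ∂ν - ν.real B * Real.log (ν.real B / c) := by
  have hpos : ∀ B, μ.real B = c → 0 < ν.real B := by
    intro B hB
    refine lt_of_le_of_ne measureReal_nonneg fun h0 => ?_
    have h1 : ν B = 0 := (measureReal_eq_zero_iff).1 h0.symm
    have h2 : μ.real B = 0 := by rw [measureReal_def, hμν h1]; rfl
    linarith
  -- For fixed `t` the majorized loss is, up to the constant `c exp t`, the `ν`-integral of `L - (1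
  -- + t)`, to which the bathtub principle applies.
  have hmin : ∀ t : ℝ, ∃ A, MeasurableSet A ∧ μ.real A = c ∧ ∀ B, MeasurableSet B → μ.real B = c →
      ∫ x in A, L x ∂ν - (1 + t) * ν.real A ≤ ∫ x in B, L x ∂ν - (1 + t) * ν.real B := by
    intro t
    have hint : Integrable (fun x => L x - (1 + t)) ν := hLi.sub (integrable_const _)
    have hval : ∀ B, ∫ x in B, (L x - (1 + t)) ∂ν = ∫ x in B, L x ∂ν - (1 + t) * ν.real B := by
      intro B
      rw [integral_sub hLi.integrableOn (integrable_const _), setIntegral_const, smul_eq_mul,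
        mul_comm]
    simp only [← hval]
    subst hν
    exact exists_minimal_setIntegral_withDensity μ hρ hρ0 (hL.sub_const _) hint hc0 hc1
  -- The least possible `ν`-mass is positive and bounds the relevant `t = log (ν B / c)` from below;
  -- `ν B ≤ 1` bounds them from above.
  obtain ⟨A₀, hA₀, hA₀c, hA₀min⟩ : ∃ A, MeasurableSet A ∧ μ.real A = c ∧
      ∀ B, MeasurableSet B → μ.real B = c → ν.real A ≤ ν.real B := by
    have h := exists_minimal_setIntegral_withDensity μ hρ hρ0 (G := fun _ => (1 : ℝ))
      measurable_const (hν ▸ integrable_const _) hc0 hc1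
    simpa only [← hν, setIntegral_const, smul_eq_mul, mul_one] using h
  choose R hRm hRc hRmin using hmin
  set M : ℝ → ℝ := fun t =>
    ∫ x in R t, L x ∂ν - (1 + t) * ν.real (R t) + c * Real.exp t with hM
  have hMle : ∀ t B, MeasurableSet B → μ.real B = c →
      M t ≤ ∫ x in B, L x ∂ν - (1 + t) * ν.real B + c * Real.exp t := fun t B hB hBc => by
    have := hRmin t B hB hBc
    simp only [hM]
    linarith
  -- The minimizer for `s` competes in the problem for `t`. This gives continuity of `M` although
  -- the choice of `R t` need not be continuous.
  have hstep : ∀ s t, M t ≤ M s + (|t - s| + |c * Real.exp t - c * Real.exp s|) := by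
    intro s t
    have h1 := hMle t (R s) (hRm s) (hRc s)
    have h2 : ν.real (R s) ≤ 1 := measureReal_le_one
    have h3 : 0 ≤ ν.real (R s) := measureReal_nonneg
    have h4 : (s - t) * ν.real (R s) ≤ |t - s| := by
      rw [abs_sub_comm]
      calc (s - t) * ν.real (R s) ≤ |s - t| * ν.real (R s) := by gcongr; exact le_abs_self _
        _ ≤ |s - t| * 1 := by gcongr
        _ = |s - t| := mul_one _
    have h5 := le_abs_self (c * Real.exp t - c * Real.exp s)
    simp only [hM] at h1 ⊢
    linarith
  have hcont : Continuous M := by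
    refine continuous_iff_continuousAt.2 fun s => tendsto_iff_dist_tendsto_zero.2 ?_
    refine squeeze_zero (fun _ => dist_nonneg)
      (g := fun t => |t - s| + |c * Real.exp t - c * Real.exp s|) (fun t => ?_) ?_
    · rw [Real.dist_eq, abs_le]
      have h1 := hstep s t
      have h2 := hstep t s
      rw [abs_sub_comm s t, abs_sub_comm (c * Real.exp s)] at h2
      constructor <;> linarith
    · have : Continuous fun t => |t - s| + |c * Real.exp t - c * Real.exp s| := by fun_prop
      simpa using this.tendsto s
  have hx₀ := hpos A₀ hA₀c
  have hlohi : Real.log (ν.real A₀ / c) ≤ Real.log (1 / c) := by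
    gcongr
    exact measureReal_le_one
  obtain ⟨t₀, -, ht₀⟩ := isCompact_Icc.exists_isMinOn
    (Set.nonempty_Icc.2 hlohi) hcont.continuousOn
  refine ⟨R t₀, hRm t₀, hRc t₀, fun B hB hBc => ?_⟩
  have hxB := hpos B hBc
  have hmem : Real.log (ν.real B / c) ∈ Set.Icc (Real.log (ν.real A₀ / c)) (Real.log (1 / c)) := by
    constructor
    · have := hA₀min B hB hBc
      gcongr
    · gcongr
      exact measureReal_le_one
  -- The loss of `R t₀` is at most `M t₀`, hence at most `M` at the tangent parameter of `B`, hence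
  -- at most the loss of `B`.
  have h1 := neg_mul_log_div_le hc0 (hpos _ (hRc t₀)) t₀
  have h2 : M t₀ ≤ M (Real.log (ν.real B / c)) := ht₀ hmem
  have h3 := hMle (Real.log (ν.real B / c)) B hB hBc
  have h4 := neg_mul_log_div_eq hc0 hxB
  have h5 : M t₀ = ∫ x in R t₀, L x ∂ν - (1 + t₀) * ν.real (R t₀) + c * Real.exp t₀ := rfl
  linarith

/-! ### Maximizers of the censored information -/

lemma measurable_sent {ψ : Strategy} (hψ : Measurable ψ) : Measurable (sent ψ) :=
  Measurable.ite (hψ (measurableSet_singleton true)) measurable_const measurable_const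

lemma measurable_llrCensored {f₀ f₁ : ℝ → ℝ} (hf₀ : IsDensity f₀) (hf₁ : IsDensity f₁)
    {ψ : Strategy} (hψ : Measurable ψ) : Measurable (llrCensored f₀ f₁ ψ) :=
  ((measurable_log_ratio hf₀ hf₁).mul (measurable_sent hψ)).add
    (measurable_const.mul (measurable_const.sub (measurable_sent hψ)))

lemma measurableSet_noSend {ψ : Strategy} (hψ : Measurable ψ) :
    MeasurableSet {x | ψ x = false} := hψ (measurableSet_singleton false)

lemma probNoSend_eq {f : ℝ → ℝ} (hf : IsDensity f) {ψ : Strategy} (hψ : Measurable ψ) :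
    probNoSend f ψ = 1 - (law f).real {x | ψ x = true} := by
  have := hf.isProbabilityMeasure_law
  have hm : MeasurableSet {x | ψ x = true} := hψ (measurableSet_singleton true)
  rw [probNoSend, ← probReal_compl_eq_one_sub hm]
  congr 1
  ext x
  simp

/-- The full divergence is a constant, so maximizing the information means minimizing the loss on
the silent region. -/
lemma infoCensored_eq {f₀ f₁ : ℝ → ℝ} (hf₁ : IsDensity f₁)
    (hLi : Integrable (fun x => Real.log (f₁ x / f₀ x)) (law f₁)) {ψ : Strategy}
    (hψ : Measurable ψ) :
    infoCensored f₀ f₁ ψ = ∫ x, Real.log (f₁ x / f₀ x) ∂(law f₁)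
      - (∫ x in {x | ψ x = false}, Real.log (f₁ x / f₀ x) ∂(law f₁)
        - probNoSend f₁ ψ * Real.log (probNoSend f₁ ψ / probNoSend f₀ ψ)) := by
  have := hf₁.isProbabilityMeasure_law
  have hS := measurableSet_noSend hψ
  have hpt : ∀ x, llrCensored f₀ f₁ ψ x = Real.log (f₁ x / f₀ x)
      - ({x | ψ x = false}.indicator (fun x => Real.log (f₁ x / f₀ x)
        - Real.log (probNoSend f₁ ψ / probNoSend f₀ ψ)) x) := by
    intro x
    cases h : ψ x <;> simp [llrCensored, sent, h]
  have hi2 : Integrable (fun x => Real.log (f₁ x / f₀ x)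
        - Real.log (probNoSend f₁ ψ / probNoSend f₀ ψ)) (law f₁) := hLi.sub (integrable_const _)
  rw [infoCensored]
  simp only [hpt]
  rw [integral_sub hLi (hi2.indicator hS), integral_indicator hS,
    integral_sub hLi.integrableOn (integrable_const _), setIntegral_const, smul_eq_mul]
  rfl

/-- An optimal censoring strategy exists for every transmission probability in `(0, 1)`. -/
lemma exists_isOptimal {f₀ f₁ : ℝ → ℝ} (hf₀ : IsDensity f₀) (hf₁ : IsDensity f₁)
    (h10 : law f₁ ≪ law f₀) (h01 : law f₀ ≪ law f₁)
    (hLi : Integrable (fun x => Real.log (f₁ x / f₀ x)) (law f₁)) {e : ℝ} (he0 : 0 < e)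
    (he1 : e < 1) : ∃ ψ, IsOptimal f₀ f₁ e ψ := by
  have := hf₀.isProbabilityMeasure_law
  have := hf₁.isProbabilityMeasure_law
  obtain ⟨A, hA, hAc, hmin⟩ := exists_minimal_information_loss (law f₀) (law f₁)
    (hf₁.measurable.div hf₀.measurable) (ratio_nonneg hf₀ hf₁) (law_eq_withDensity hf₀ hf₁ h10)
    h01 (measurable_log_ratio hf₀ hf₁) hLi (c := 1 - e) (by linarith) (by linarith)
  classical
  set ψ : Strategy := fun x => if x ∈ A then false else true with hψdef
  have hψ : Measurable ψ := Measurable.ite hA measurable_const measurable_const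
  have hAψ : {x | ψ x = false} = A := by
    ext x
    simp [hψdef]
  have hp0 : probNoSend f₀ ψ = 1 - e := by rw [probNoSend, hAψ, hAc]
  have hp1 : probNoSend f₁ ψ = (law f₁).real A := by rw [probNoSend, hAψ]
  refine ⟨ψ, ⟨hψ, ?_⟩, fun φ hφ => ?_⟩
  · linarith [probNoSend_eq hf₀ hψ]
  · have hq0 : probNoSend f₀ φ = 1 - e := by rw [probNoSend_eq hf₀ hφ.1, hφ.2]
    have h := hmin {x | φ x = false} (measurableSet_noSend hφ.1) hq0
    rw [Set.mem_ofPred, infoCensored_eq hf₁ hLi hψ, infoCensored_eq hf₁ hLi hφ.1, hp0, hp1, hq0,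
      hAψ]
    exact sub_le_sub_left h _

/-- Sending everything is optimal among the strategies that send with probability one. -/
lemma exists_isOptimal_one {f₀ f₁ : ℝ → ℝ} (hf₀ : IsDensity f₀) (h10 : law f₁ ≪ law f₀) :
    ∃ ψ, IsOptimal f₀ f₁ 1 ψ := by
  have := hf₀.isProbabilityMeasure_law
  refine ⟨fun _ => true, ⟨measurable_const, by simp⟩, fun φ hφ => ?_⟩
  have h0 : probNoSend f₀ φ = 0 := by rw [probNoSend_eq hf₀ hφ.1, hφ.2, sub_self]
  have h1 : ∀ᵐ x ∂(law f₀), φ x = true := by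
    rw [probNoSend, measureReal_eq_zero_iff] at h0
    simpa [ae_iff] using h0
  have h2 : llrCensored f₀ f₁ φ =ᵐ[law f₁] llrCensored f₀ f₁ fun _ => true := by
    filter_upwards [h10.ae_le h1] with x hx
    simp [llrCensored, sent, hx]
  exact (integral_congr_ae h2).le

/-! ### Chains driven by independent observations -/

section Chain

variable {Ω : Type*} {X : ℕ → Ω → ℝ}

/-- The σ-algebra generated by the first `k` observations. -/
abbrev past {Ω : Type*} (X : ℕ → Ω → ℝ) (k : ℕ) : MeasurableSpace Ω :=
  ⨆ j ∈ Set.Iio k, MeasurableSpace.comap (X j) inferInstance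

lemma past_mono {Ω : Type*} (X : ℕ → Ω → ℝ) {j k : ℕ} (h : j ≤ k) : past X j ≤ past X k :=
  biSup_mono fun _ hi => lt_of_lt_of_le hi h

lemma measurable_past {Ω : Type*} (X : ℕ → Ω → ℝ) {j k : ℕ} (h : j < k) :
    Measurable[past X k] (X j) :=
  Measurable.mono (comap_measurable (X j))
    (le_biSup (fun j => MeasurableSpace.comap (X j) inferInstance) (Set.mem_Iio.2 h)) le_rfl

variable {σ : ℕ → Ω → ℝ} {u : ℝ → ℝ → ℝ} {s₀ : ℝ} {w : ℝ → ℝ → ENNReal} {V : ℝ → ENNReal}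

lemma measurable_chain (hσ0 : ∀ ω, σ 0 ω = s₀) (hσ : ∀ k ω, σ (k + 1) ω = u (σ k ω) (X k ω))
    (hu : Measurable (Function.uncurry u)) (k : ℕ) : Measurable[past X k] (σ k) := by
  induction k with
  | zero =>
    rw [show σ 0 = fun _ => s₀ from funext hσ0]
    exact measurable_const
  | succ k ih =>
    rw [show σ (k + 1) = fun ω => u (σ k ω) (X k ω) from funext (hσ k)]
    exact hu.comp ((ih.mono (past_mono X k.le_succ) le_rfl).prodMk
      (measurable_past X k.lt_succ_self))

lemma measurable_prod_weight (hσ0 : ∀ ω, σ 0 ω = s₀)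
    (hσ : ∀ k ω, σ (k + 1) ω = u (σ k ω) (X k ω)) (hu : Measurable (Function.uncurry u))
    (hw : Measurable (Function.uncurry w)) (k : ℕ) :
    Measurable[past X k] fun ω => ∏ j ∈ Finset.range k, w (σ j ω) (X j ω) := by
  refine Finset.measurable_fun_prod _ fun j hj => ?_
  have hjk := Finset.mem_range.1 hj
  exact hw.comp (((measurable_chain hσ0 hσ hu j).mono (past_mono X hjk.le) le_rfl).prodMk
    (measurable_past X hjk))

variable [MeasurableSpace Ω] {P : Measure Ω}

lemma indep_past (hX_meas : ∀ k, Measurable (X k)) (hX_indep : iIndepFun X P) (k : ℕ) :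
    Indep (past X k) (MeasurableSpace.comap (X k) inferInstance) P := by
  have h := indep_iSup_of_disjoint (m := fun j => MeasurableSpace.comap (X j) inferInstance)
    (fun j => (hX_meas j).comap_le) hX_indep (S := Set.Iio k) (T := {k})
    (Set.disjoint_singleton_right.2 (lt_irrefl k))
  simpa only [iSup_singleton] using h

lemma past_le (hX_meas : ∀ k, Measurable (X k)) (k : ℕ) : past X k ≤ ‹MeasurableSpace Ω› :=
  iSup₂_le fun j _ => (hX_meas j).comap_le

variable [IsProbabilityMeasure P] {μ : Measure ℝ} [IsProbabilityMeasure μ]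

/-- Integrating out the observation that follows the first `k` ones. -/
lemma lintegral_mul_next (hX_meas : ∀ k, Measurable (X k)) (hX_indep : iIndepFun X P)
    (hX_law : ∀ k, P.map (X k) = μ) (k : ℕ) {Z : Ω → ENNReal} {s : Ω → ℝ}
    (hZ : Measurable[past X k] Z) (hs : Measurable[past X k] s) {F : ℝ → ℝ → ENNReal}
    (hF : Measurable (Function.uncurry F)) :
    ∫⁻ ω, Z ω * F (s ω) (X k ω) ∂P = ∫⁻ ω, Z ω * ∫⁻ x, F (s ω) x ∂μ ∂P := by
  have hZs : Measurable[past X k] fun ω => (Z ω, s ω) := hZ.prodMk hs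
  have hind : IndepFun (fun ω => (Z ω, s ω)) (X k) P := by
    rw [IndepFun_iff_Indep]
    exact indep_of_indep_of_le_left (indep_past hX_meas hX_indep k) hZs.comap_le
  have hZs' : Measurable fun ω => (Z ω, s ω) := hZs.mono (past_le hX_meas k) le_rfl
  have hmap := (indepFun_iff_map_prod_eq_prod_map_map hZs'.aemeasurable
    (hX_meas k).aemeasurable).1 hind
  rw [hX_law k] at hmap
  have := Measure.isProbabilityMeasure_map (μ := P) hZs'.aemeasurable
  have hF3 : Measurable fun q : (ENNReal × ℝ) × ℝ => F q.1.2 q.2 :=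
    hF.comp ((measurable_snd.comp measurable_fst).prodMk measurable_snd)
  have hG : Measurable fun q : (ENNReal × ℝ) × ℝ => q.1.1 * F q.1.2 q.2 :=
    (measurable_fst.comp measurable_fst).mul hF3
  calc ∫⁻ ω, Z ω * F (s ω) (X k ω) ∂P
      = ∫⁻ q, q.1.1 * F q.1.2 q.2 ∂(P.map fun ω => ((Z ω, s ω), X k ω)) := by
        rw [lintegral_map hG (hZs'.prodMk (hX_meas k))]
    _ = ∫⁻ p, ∫⁻ x, p.1 * F p.2 x ∂μ ∂(P.map fun ω => (Z ω, s ω)) := by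
        rw [hmap, lintegral_prod _ hG.aemeasurable]
    _ = ∫⁻ p, p.1 * ∫⁻ x, F p.2 x ∂μ ∂(P.map fun ω => (Z ω, s ω)) := by
        refine lintegral_congr fun p => lintegral_const_mul _ ?_
        exact hF.comp measurable_prodMk_left
    _ = ∫⁻ ω, Z ω * ∫⁻ x, F (s ω) x ∂μ ∂P := by
        rw [lintegral_map _ hZs']
        exact measurable_fst.mul (hF.lintegral_prod_right.comp measurable_snd)

lemma lintegral_prod_weight_succ (hX_meas : ∀ k, Measurable (X k)) (hX_indep : iIndepFun X P)
    (hX_law : ∀ k, P.map (X k) = μ) (hσ0 : ∀ ω, σ 0 ω = s₀)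
    (hσ : ∀ k ω, σ (k + 1) ω = u (σ k ω) (X k ω)) (hu : Measurable (Function.uncurry u))
    (hw : Measurable (Function.uncurry w)) (hV : Measurable V) (n : ℕ) :
    ∫⁻ ω, (∏ j ∈ Finset.range (n + 1), w (σ j ω) (X j ω)) * V (σ (n + 1) ω) ∂P
      = ∫⁻ ω, (∏ j ∈ Finset.range n, w (σ j ω) (X j ω)) *
          ∫⁻ x, w (σ n ω) x * V (u (σ n ω) x) ∂μ ∂P := by
  simp only [Finset.prod_range_succ, hσ n, mul_assoc]
  exact lintegral_mul_next hX_meas hX_indep hX_law n (measurable_prod_weight hσ0 hσ hu hw n)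
    (measurable_chain hσ0 hσ hu n) (F := fun s x => w s x * V (u s x)) (hw.mul (hV.comp hu))

/-- A supersolution `V` of the weighted one-step inequality bounds the weighted expectations from
above. -/
lemma lintegral_prod_weight_le (hX_meas : ∀ k, Measurable (X k)) (hX_indep : iIndepFun X P)
    (hX_law : ∀ k, P.map (X k) = μ) (hσ0 : ∀ ω, σ 0 ω = s₀)
    (hσ : ∀ k ω, σ (k + 1) ω = u (σ k ω) (X k ω)) (hu : Measurable (Function.uncurry u))
    (hw : Measurable (Function.uncurry w)) (hV : Measurable V) {C : ENNReal}
    (hstep : ∀ s, ∫⁻ x, w s x * V (u s x) ∂μ ≤ C * V s) (n : ℕ) :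
    ∫⁻ ω, (∏ j ∈ Finset.range n, w (σ j ω) (X j ω)) * V (σ n ω) ∂P ≤ C ^ n * V s₀ := by
  induction n with
  | zero => simp [hσ0]
  | succ n ih =>
    rw [lintegral_prod_weight_succ hX_meas hX_indep hX_law hσ0 hσ hu hw hV]
    have hmeas : Measurable fun ω => (∏ j ∈ Finset.range n, w (σ j ω) (X j ω)) * V (σ n ω) :=
      Measurable.mono (Measurable.mul (measurable_prod_weight hσ0 hσ hu hw n)
        (hV.comp (measurable_chain hσ0 hσ hu n))) (past_le hX_meas n) le_rfl
    calc _ ≤ ∫⁻ ω, C * ((∏ j ∈ Finset.range n, w (σ j ω) (X j ω)) * V (σ n ω)) ∂P := by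
          refine lintegral_mono fun ω => ?_
          rw [mul_left_comm]
          gcongr
          exact hstep _
      _ = C * ∫⁻ ω, (∏ j ∈ Finset.range n, w (σ j ω) (X j ω)) * V (σ n ω) ∂P :=
          lintegral_const_mul _ hmeas
      _ ≤ C * (C ^ n * V s₀) := by gcongr
      _ = C ^ (n + 1) * V s₀ := by ring

/-- A subsolution `V` of the weighted one-step inequality bounds the weighted expectations from
below. -/
lemma le_lintegral_prod_weight (hX_meas : ∀ k, Measurable (X k)) (hX_indep : iIndepFun X P)
    (hX_law : ∀ k, P.map (X k) = μ) (hσ0 : ∀ ω, σ 0 ω = s₀)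
    (hσ : ∀ k ω, σ (k + 1) ω = u (σ k ω) (X k ω)) (hu : Measurable (Function.uncurry u))
    (hw : Measurable (Function.uncurry w)) (hV : Measurable V) {C : ENNReal}
    (hstep : ∀ s, C * V s ≤ ∫⁻ x, w s x * V (u s x) ∂μ) (n : ℕ) :
    C ^ n * V s₀ ≤ ∫⁻ ω, (∏ j ∈ Finset.range n, w (σ j ω) (X j ω)) * V (σ n ω) ∂P := by
  induction n with
  | zero => simp [hσ0]
  | succ n ih =>
    rw [lintegral_prod_weight_succ hX_meas hX_indep hX_law hσ0 hσ hu hw hV]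
    have hmeas : Measurable fun ω => (∏ j ∈ Finset.range n, w (σ j ω) (X j ω)) * V (σ n ω) :=
      Measurable.mono (Measurable.mul (measurable_prod_weight hσ0 hσ hu hw n)
        (hV.comp (measurable_chain hσ0 hσ hu n))) (past_le hX_meas n) le_rfl
    calc C ^ (n + 1) * V s₀ = C * (C ^ n * V s₀) := by ring
      _ ≤ C * ∫⁻ ω, (∏ j ∈ Finset.range n, w (σ j ω) (X j ω)) * V (σ n ω) ∂P := by gcongr
      _ = ∫⁻ ω, C * ((∏ j ∈ Finset.range n, w (σ j ω) (X j ω)) * V (σ n ω)) ∂P :=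
          (lintegral_const_mul _ hmeas).symm
      _ ≤ _ := by
          refine lintegral_mono fun ω => ?_
          rw [mul_left_comm]
          gcongr
          exact hstep _

end Chain

/-! ### One-step inequalities for the detection statistic -/

lemma sent_policy (a₁ : ℝ) (ψtop ψlow : Strategy) (s x : ℝ) :
    sent (policy a₁ ψtop ψlow s) x = if a₁ ≤ s then sent ψtop x else sent ψlow x := by
  unfold policy
  split_ifs <;> rfl

lemma llrCensored_policy (f₀ f₁ : ℝ → ℝ) (a₁ : ℝ) (ψtop ψlow : Strategy) (s x : ℝ) :
    llrCensored f₀ f₁ (policy a₁ ψtop ψlow s) x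
      = if a₁ ≤ s then llrCensored f₀ f₁ ψtop x else llrCensored f₀ f₁ ψlow x := by
  unfold policy
  split_ifs <;> rfl

lemma sent_nonneg (ψ : Strategy) (x : ℝ) : 0 ≤ sent ψ x := by
  unfold sent
  split_ifs <;> norm_num

lemma sent_le_one (ψ : Strategy) (x : ℝ) : sent ψ x ≤ 1 := by
  unfold sent
  split_ifs <;> norm_num

lemma measurable_sent_policy (a₁ : ℝ) {ψtop ψlow : Strategy} (ht : Measurable ψtop)
    (hl : Measurable ψlow) :
    Measurable (Function.uncurry fun s x => sent (policy a₁ ψtop ψlow s) x) := by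
  simp only [sent_policy]
  exact Measurable.ite (measurableSet_le measurable_const measurable_fst)
    ((measurable_sent ht).comp measurable_snd) ((measurable_sent hl).comp measurable_snd)

lemma measurable_update {f₀ f₁ : ℝ → ℝ} (hf₀ : IsDensity f₀) (hf₁ : IsDensity f₁) (a₁ : ℝ)
    {ψtop ψlow : Strategy} (ht : Measurable ψtop) (hl : Measurable ψlow) :
    Measurable (Function.uncurry (update f₀ f₁ a₁ ψtop ψlow)) := by
  have hp : Measurable (Function.uncurry (preUpdate f₀ f₁ a₁ ψtop ψlow)) := by
    refine measurable_const.max (measurable_fst.add ?_)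
    simp only [llrCensored_policy]
    exact Measurable.ite (measurableSet_le measurable_const measurable_fst)
      ((measurable_llrCensored hf₀ hf₁ ht).comp measurable_snd)
      ((measurable_llrCensored hf₀ hf₁ hl).comp measurable_snd)
  exact Measurable.ite ((measurableSet_lt measurable_fst measurable_const).inter
    (measurableSet_le measurable_const hp)) measurable_const hp

/-- From below, the reset is a cap at `a₁`, which is why no bound on the overshoot of a transmitted
log-likelihood ratio is needed. -/
lemma update_of_lt {f₀ f₁ : ℝ → ℝ} {a₁ s : ℝ} (hs : s < a₁) (ψtop ψlow : Strategy) (x : ℝ) :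
    update f₀ f₁ a₁ ψtop ψlow s x = min a₁ (max 0 (s + llrCensored f₀ f₁ ψlow x)) := by
  rw [update, preUpdate, llrCensored_policy, if_neg (not_le.2 hs)]
  split_ifs with h
  · exact (min_eq_left h.2).symm
  · exact (min_eq_right (not_le.1 fun h' => h ⟨hs, h'⟩).le).symm

lemma update_of_le {f₀ f₁ : ℝ → ℝ} {a₁ s : ℝ} (hs : a₁ ≤ s) (ψtop ψlow : Strategy) (x : ℝ) :
    update f₀ f₁ a₁ ψtop ψlow s x = max 0 (s + llrCensored f₀ f₁ ψtop x) := by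
  rw [update, preUpdate, llrCensored_policy, if_pos hs, if_neg fun h => not_lt.2 hs h.1]

lemma ae_sent_top {f₀ : ℝ → ℝ} (hf₀ : IsDensity f₀) {ψ : Strategy}
    (hψ : ψ ∈ strategyClass f₀ 1) : ∀ᵐ x ∂(law f₀), ψ x = true := by
  have := hf₀.isProbabilityMeasure_law
  have h0 : probNoSend f₀ ψ = 0 := by rw [probNoSend_eq hf₀ hψ.1, hψ.2, sub_self]
  rw [probNoSend, measureReal_eq_zero_iff] at h0
  simpa [ae_iff] using h0

lemma llrCensored_of_true {f₀ f₁ : ℝ → ℝ} {ψ : Strategy} {x : ℝ} (h : ψ x = true) :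
    llrCensored f₀ f₁ ψ x = Real.log (f₁ x / f₀ x) := by
  simp [llrCensored, sent, h]

/-- The increment of the statistic when nothing is sent is small for rare transmissions. -/
lemma llrCensored_le_of_false {f₀ f₁ : ℝ → ℝ} (hf₀ : IsDensity f₀) (hf₁ : IsDensity f₁)
    {ψ : Strategy} {e : ℝ} (hψ : ψ ∈ strategyClass f₀ e) (he0 : 0 ≤ e) (he1 : e < 1) {x : ℝ}
    (h : ψ x = false) : llrCensored f₀ f₁ ψ x ≤ -Real.log (1 - e) := by
  have := hf₁.isProbabilityMeasure_law
  have h0 : probNoSend f₀ ψ = 1 - e := by rw [probNoSend_eq hf₀ hψ.1, hψ.2]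
  have h1 : probNoSend f₁ ψ ≤ 1 := measureReal_le_one
  have h2 : 0 ≤ probNoSend f₁ ψ := measureReal_nonneg
  have h3 : llrCensored f₀ f₁ ψ x = Real.log (probNoSend f₁ ψ / (1 - e)) := by
    simp [llrCensored, sent, h, h0]
  have hpos : 0 < 1 - e := by linarith
  rw [h3, ← Real.log_inv]
  rcases h2.eq_or_lt with h4 | h4
  -- Here the logarithm takes its default value `log 0 = 0`, and the bound is nonnegative.
  · rw [← h4, zero_div, Real.log_zero, Real.log_inv]
    linarith [Real.log_nonpos hpos.le (by linarith)]
  · refine Real.log_le_log (by positivity) ?_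
    rw [div_eq_mul_inv]
    exact mul_le_of_le_one_left (by positivity) h1

lemma integral_sent {f₀ : ℝ → ℝ} {ψ : Strategy} {e : ℝ} (hψ : ψ ∈ strategyClass f₀ e) :
    ∫ x, sent ψ x ∂(law f₀) = e := by
  have hm : MeasurableSet {x | ψ x = true} := hψ.1 (measurableSet_singleton true)
  have h : sent ψ = {x | ψ x = true}.indicator 1 := by
    ext x
    simp [sent, Set.indicator]
  rw [h, integral_indicator_one hm, hψ.2]

lemma integrable_sent {f₀ : ℝ → ℝ} (hf₀ : IsDensity f₀) {ψ : Strategy} (hψ : Measurable ψ) :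
    Integrable (sent ψ) (law f₀) := by
  have := hf₀.isProbabilityMeasure_law
  refine (integrable_const (1 : ℝ)).mono' (measurable_sent hψ).aestronglyMeasurable
    (ae_of_all _ fun x => ?_)
  rw [Real.norm_of_nonneg (sent_nonneg ψ x)]
  exact sent_le_one ψ x

lemma lintegral_ofReal_le_of_ae_le {α : Type*} [MeasurableSpace α] {μ : Measure α} {G H : α → ℝ}
    {K : ℝ} (hH0 : ∀ x, 0 ≤ H x) (hHi : Integrable H μ) (hGH : ∀ᵐ x ∂μ, G x ≤ H x)
    (hK : ∫ x, H x ∂μ ≤ K) : ∫⁻ x, ENNReal.ofReal (G x) ∂μ ≤ ENNReal.ofReal K := by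
  calc ∫⁻ x, ENNReal.ofReal (G x) ∂μ ≤ ∫⁻ x, ENNReal.ofReal (H x) ∂μ :=
        lintegral_mono_ae (hGH.mono fun x hx => ENNReal.ofReal_le_ofReal hx)
    _ = ENNReal.ofReal (∫ x, H x ∂μ) :=
        (ofReal_integral_eq_lintegral_ofReal hHi (ae_of_all _ hH0)).symm
    _ ≤ ENNReal.ofReal K := ENNReal.ofReal_le_ofReal hK

/-- The minorant `H` may be negative, so it passes through its positive part. -/
lemma le_lintegral_ofReal_of_ae_le {α : Type*} [MeasurableSpace α] {μ : Measure α} {G H : α → ℝ}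
    {K : ℝ} (hHi : Integrable H μ) (hHG : ∀ᵐ x ∂μ, H x ≤ G x)
    (hK : K ≤ ∫ x, H x ∂μ) : ENNReal.ofReal K ≤ ∫⁻ x, ENNReal.ofReal (G x) ∂μ := by
  calc ENNReal.ofReal K ≤ ENNReal.ofReal (∫ x, max (H x) 0 ∂μ) :=
        ENNReal.ofReal_le_ofReal
          (hK.trans (integral_mono hHi hHi.pos_part fun x => le_max_left _ _))
    _ = ∫⁻ x, ENNReal.ofReal (max (H x) 0) ∂μ :=
        ofReal_integral_eq_lintegral_ofReal hHi.pos_part (ae_of_all _ fun x => le_max_right _ _)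
    _ = ∫⁻ x, ENNReal.ofReal (H x) ∂μ := by
        refine lintegral_congr fun x => ?_
        simp [ENNReal.ofReal_max]
    _ ≤ ∫⁻ x, ENNReal.ofReal (G x) ∂μ :=
        lintegral_mono_ae (hHG.mono fun x hx => ENNReal.ofReal_le_ofReal hx)

/-- The truncated and normalized negative part of the log-likelihood ratio. -/
def dropFraction (f₀ f₁ : ℝ → ℝ) (a₁ x : ℝ) : ℝ :=
  min 1 (max 0 (-Real.log (f₁ x / f₀ x)) / a₁)

lemma dropFraction_nonneg {a₁ : ℝ} (ha₁ : 0 < a₁) (f₀ f₁ : ℝ → ℝ) (x : ℝ) :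
    0 ≤ dropFraction f₀ f₁ a₁ x := by
  unfold dropFraction
  positivity

lemma dropFraction_le_one (f₀ f₁ : ℝ → ℝ) (a₁ x : ℝ) : dropFraction f₀ f₁ a₁ x ≤ 1 :=
  min_le_left _ _

lemma integrable_dropFraction {f₀ f₁ : ℝ → ℝ} (hf₀ : IsDensity f₀) (hf₁ : IsDensity f₁) {a₁ : ℝ}
    (ha₁ : 0 < a₁) : Integrable (dropFraction f₀ f₁ a₁) (law f₀) := by
  have := hf₀.isProbabilityMeasure_law
  refine (integrable_const (1 : ℝ)).mono' ?_ (ae_of_all _ fun x => ?_)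
  · exact (measurable_const.min ((measurable_const.max
      (measurable_log_ratio hf₀ hf₁).neg).div_const a₁)).aestronglyMeasurable
  · rw [Real.norm_of_nonneg (dropFraction_nonneg ha₁ f₀ f₁ x)]
    exact dropFraction_le_one f₀ f₁ a₁ x

lemma max_zero_add_div {a₁ l : ℝ} (ha₁ : 0 < a₁) (hl : l ≤ 0) :
    max 0 (a₁ + l) / a₁ = 1 - min 1 (max 0 (-l) / a₁) := by
  rw [max_eq_right (by linarith : (0 : ℝ) ≤ -l)]
  rcases le_total 0 (a₁ + l) with h | h
  · have h1 : -l / a₁ ≤ 1 := by rw [div_le_one ha₁]; linarith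
    rw [max_eq_right h, min_eq_right h1]
    field_simp
    ring
  · have h1 : 1 ≤ -l / a₁ := by rw [le_div_iff₀ ha₁]; linarith
    rw [max_eq_left h, min_eq_left h1]
    simp

/-- A supersolution for the exponential moments of the number of transmissions. -/
def superSol (a₁ z s : ℝ) : ℝ :=
  if s ≤ a₁ then 1 + max 0 s / a₁ else 2 + z * Real.exp ((s - a₁) / 2)

/-- A subsolution for the probability of never exceeding `a₁`. -/
def subSol (a₁ c s : ℝ) : ℝ :=
  if s ≤ a₁ then 1 - c * (max 0 s / a₁) else 0

lemma measurable_superSol (a₁ z : ℝ) : Measurable (superSol a₁ z) :=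
  Measurable.ite measurableSet_Iic (by fun_prop) (by fun_prop)

lemma measurable_subSol (a₁ c : ℝ) : Measurable (subSol a₁ c) :=
  Measurable.ite measurableSet_Iic (by fun_prop) measurable_const

/-! ### The test functions after one step -/

section

variable {a₁ : ℝ} (ha₁ : 0 < a₁)

include ha₁

lemma max_div_le_one {s : ℝ} (hs : s ≤ a₁) : max 0 s / a₁ ≤ 1 :=
  (div_le_one ha₁).2 (max_le ha₁.le hs)

lemma one_le_superSol {z : ℝ} (hz : 0 ≤ z) (s : ℝ) : 1 ≤ superSol a₁ z s := by
  unfold superSol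
  split_ifs
  · have : 0 ≤ max 0 s / a₁ := by positivity
    linarith
  · have : 0 ≤ z * Real.exp ((s - a₁) / 2) := by positivity
    linarith

lemma superSol_zero (z : ℝ) : superSol a₁ z 0 = 1 := by
  simp [superSol, ha₁.le]

lemma subSol_zero (c : ℝ) : subSol a₁ c 0 = 1 := by
  simp [subSol, ha₁.le]

lemma superSol_le_two {z s : ℝ} (hs : s ≤ a₁) : superSol a₁ z s ≤ 2 := by
  rw [superSol, if_pos hs]
  linarith [max_div_le_one ha₁ hs]

lemma le_subSol {c s : ℝ} (hc : 0 ≤ c) (hs : s ≤ a₁) : 1 - c ≤ subSol a₁ c s := by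
  rw [subSol, if_pos hs]
  have := mul_le_mul_of_nonneg_left (max_div_le_one ha₁ hs) hc
  linarith

lemma subSol_nonneg {c : ℝ} (hc0 : 0 ≤ c) (hc1 : c ≤ 1) (s : ℝ) : 0 ≤ subSol a₁ c s := by
  by_cases hs : s ≤ a₁
  · linarith [le_subSol ha₁ hc0 hs]
  · rw [subSol, if_neg hs]

lemma subSol_le_one {c : ℝ} (hc0 : 0 ≤ c) (s : ℝ) : subSol a₁ c s ≤ 1 := by
  unfold subSol
  split_ifs
  · have : 0 ≤ c * (max 0 s / a₁) := by positivity
    linarith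
  · norm_num

/-- A step of size at most `B`, capped at `a₁`, increases the normalized statistic by at most
`B / a₁`. -/
lemma max_min_div_le {s l B : ℝ} (hB : 0 ≤ B) (hl : l ≤ B) :
    max 0 (min a₁ (max 0 (s + l))) / a₁ ≤ max 0 s / a₁ + B / a₁ := by
  rw [← add_div]
  refine div_le_div_of_nonneg_right ?_ ha₁.le
  have h1 : 0 ≤ max 0 s := le_max_left _ _
  have h2 : s ≤ max 0 s := le_max_right _ _
  refine max_le (by linarith) ((min_le_right _ _).trans (max_le (by linarith) (by linarith)))

lemma superSol_le_two_add {z : ℝ} (hz : 0 ≤ z) (s l : ℝ) :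
    superSol a₁ z (max 0 (s + l))
      ≤ 2 + z * (Real.exp ((s - a₁) / 2) * Real.exp (l / 2)) := by
  by_cases h : max 0 (s + l) ≤ a₁
  · have h1 := superSol_le_two (z := z) ha₁ h
    have : 0 ≤ z * (Real.exp ((s - a₁) / 2) * Real.exp (l / 2)) := by positivity
    linarith
  · rw [superSol, if_neg h, ← Real.exp_add]
    have h2 : max 0 (s + l) = s + l := by
      refine max_eq_right ?_
      by_contra hneg
      exact h (by rw [max_eq_left (not_le.1 hneg).le]; exact ha₁.le)
    rw [h2]
    refine le_of_eq ?_
    congr 3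
    ring

/-- From `a₁` a downward step gains the drop fraction and an upward step costs the exponential term;
the sum covers both signs of `l`. -/
lemma superSol_boundary_le {z : ℝ} (hz : 0 ≤ z) (l : ℝ) :
    superSol a₁ z (max 0 (a₁ + l))
      ≤ 2 - min 1 (max 0 (-l) / a₁) + z * Real.exp (l / 2) := by
  have hzl : 0 ≤ z * Real.exp (l / 2) := by positivity
  rcases le_or_gt l 0 with hl | hl
  · have h1 : max 0 (a₁ + l) ≤ a₁ := max_le ha₁.le (by linarith)
    rw [superSol, if_pos h1, max_eq_right (le_max_left 0 (a₁ + l)), max_zero_add_div ha₁ hl]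
    linarith
  · have h1 := superSol_le_two_add ha₁ hz a₁ l
    have h2 : min 1 (max 0 (-l) / a₁) = 0 := by
      rw [max_eq_left (by linarith : -l ≤ 0)]
      simp
    rw [h2]
    simpa using h1

lemma subSol_boundary_ge {c : ℝ} (hc0 : 0 ≤ c) (hc1 : c ≤ 1) (l : ℝ) :
    c * min 1 (max 0 (-l) / a₁) ≤ subSol a₁ c (max 0 (a₁ + l)) := by
  rcases le_or_gt l 0 with hl | hl
  · have h1 : max 0 (a₁ + l) ≤ a₁ := max_le ha₁.le (by linarith)
    rw [subSol, if_pos h1, max_eq_right (le_max_left 0 (a₁ + l)), max_zero_add_div ha₁ hl]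
    linarith
  · rw [max_eq_left (by linarith : -l ≤ 0)]
    simpa using subSol_nonneg ha₁ hc0 hc1 _

end

section OneStep

variable {f₀ f₁ : ℝ → ℝ} (hf₀ : IsDensity f₀) (hf₁ : IsDensity f₁) {a₁ e : ℝ} (ha₁ : 0 < a₁)
  (he0 : 0 < e) (he1 : e < 1) {ψtop ψlow : Strategy} (ht : ψtop ∈ strategyClass f₀ 1)
  (hl : ψlow ∈ strategyClass f₀ e)

include hf₀ hf₁ ha₁ he0 he1 ht hl

/-- One-step inequality for the exponential moments of the number of transmissions. -/
lemma lintegral_superSol_le (h10 : law f₁ ≪ law f₀) (h01 : law f₀ ≪ law f₁) {θ g : ℝ}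
    (hθ : 0 ≤ θ) (hg0 : 0 < g) (hg : ∫ x, dropFraction f₀ f₁ a₁ x ∂(law f₀) = g)
    (hβ : ∫ x, Real.exp (Real.log (f₁ x / f₀ x) / 2) ∂(law f₀) ≤ 1)
    (hθ1 : Real.exp θ * (2 - g / 2) ≤ 2)
    (hθ2 : 2 * (Real.exp θ - 1) ≤ g / 2 *
      (1 - Real.exp θ * ∫ x, Real.exp (Real.log (f₁ x / f₀ x) / 2) ∂(law f₀))) (s : ℝ) :
    ∫⁻ x, ENNReal.ofReal (Real.exp (θ * sent (policy a₁ ψtop ψlow s) x)) *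
        ENNReal.ofReal (superSol a₁ (g / 2) (update f₀ f₁ a₁ ψtop ψlow s x)) ∂(law f₀)
      ≤ ENNReal.ofReal (1 + (-Real.log (1 - e) / a₁ + 2 * Real.exp θ * e)) *
        ENNReal.ofReal (superSol a₁ (g / 2) s) := by
  have := hf₀.isProbabilityMeasure_law
  set z := g / 2 with hz
  have hz0 : 0 < z := by positivity
  set B := -Real.log (1 - e) with hB
  have hB0 : 0 ≤ B := by
    have := Real.log_nonpos (by linarith : 0 ≤ 1 - e) (by linarith)
    linarith
  have heθ : 1 ≤ Real.exp θ := Real.one_le_exp hθ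
  have hη : 0 ≤ B / a₁ + 2 * Real.exp θ * e := by positivity
  have hV1 := one_le_superSol ha₁ hz0.le s
  have hexp := integrable_exp_half hf₀ hf₁ h10 h01
  have hdrop := integrable_dropFraction hf₀ hf₁ ha₁
  set β := ∫ x, Real.exp (Real.log (f₁ x / f₀ x) / 2) ∂(law f₀) with hβdef
  simp only [← ENNReal.ofReal_mul (Real.exp_pos _).le]
  rw [← ENNReal.ofReal_mul (by linarith)]
  rcases lt_trichotomy s a₁ with hs | hs | hs
  · have hsi := integrable_sent hf₀ hl.1
    -- A silent step adds at most `B / a₁`; a transmission costs a factor `exp θ` and, by the cap,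
    -- ends at a value of at most `2`. The bound `1 ≤ superSol` makes these additive errors
    -- multiplicative.
    refine lintegral_ofReal_le_of_ae_le
      (H := fun x => superSol a₁ z s + B / a₁ + 2 * Real.exp θ * sent ψlow x) (fun x => ?_)
      ((integrable_const _).add (hsi.const_mul _)) (ae_of_all _ fun x => ?_) ?_
    · have := sent_nonneg ψlow x
      have : 0 ≤ superSol a₁ z s := by linarith
      positivity
    · simp only [sent_policy, if_neg (not_le.2 hs), update_of_lt hs]
      have hcap : min a₁ (max 0 (s + llrCensored f₀ f₁ ψlow x)) ≤ a₁ := min_le_left _ _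
      have hBa : 0 ≤ B / a₁ := by positivity
      cases hx : ψlow x
      · have h1 := max_min_div_le ha₁ (s := s) hB0 (llrCensored_le_of_false hf₀ hf₁ hl he0.le he1 hx)
        simp only [sent, hx, Bool.false_eq_true, if_false, mul_zero, Real.exp_zero, one_mul,
          add_zero]
        rw [superSol, if_pos hcap, superSol, if_pos hs.le]
        linarith
      · have h1 := superSol_le_two (z := z) ha₁ hcap
        simp only [sent, hx, if_true, mul_one]
        have h2 := mul_le_mul_of_nonneg_left h1 (Real.exp_pos θ).le
        linarith
    · rw [integral_add (integrable_const _) (hsi.const_mul _), integral_const_mul,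
        integral_sent hl]
      simp only [integral_const, probReal_univ, one_smul]
      nlinarith [mul_le_mul_of_nonneg_left hV1 hη]
  · refine lintegral_ofReal_le_of_ae_le (H := fun x => Real.exp θ * (2 - dropFraction f₀ f₁ a₁ x
      + z * Real.exp (Real.log (f₁ x / f₀ x) / 2))) (fun x => ?_)
      ((((integrable_const _).sub hdrop).add (hexp.const_mul _)).const_mul _) ?_ ?_
    · have h1 := dropFraction_le_one f₀ f₁ a₁ x
      have h2 : 0 ≤ z * Real.exp (Real.log (f₁ x / f₀ x) / 2) := by positivity
      exact mul_nonneg (Real.exp_pos _).le (by linarith)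
    · filter_upwards [ae_sent_top hf₀ ht] with x hx
      rw [sent_policy, if_pos hs.ge, update_of_le hs.ge, llrCensored_of_true hx, hs]
      simp only [sent, hx, if_true, mul_one]
      exact mul_le_mul_of_nonneg_left (superSol_boundary_le ha₁ hz0.le _) (Real.exp_pos _).le
    · have hsub : Integrable (fun x => 2 - dropFraction f₀ f₁ a₁ x) (law f₀) :=
        (integrable_const _).sub hdrop
      rw [integral_const_mul, integral_add hsub (hexp.const_mul _),
        integral_sub (integrable_const _) hdrop, integral_const_mul, hg, ← hβdef]
      simp only [integral_const, probReal_univ, one_smul]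
      have hVa : superSol a₁ z s = 2 := by
        rw [superSol, if_pos hs.le, hs, max_eq_right ha₁.le, div_self ha₁.ne']
        norm_num
      rw [hVa]
      -- With `z = g / 2` the mean drop `g` pays for `z β ≤ z` and leaves `z` against the factor
      -- `exp θ`.
      have h1 : Real.exp θ * (2 - g + z * β) ≤ Real.exp θ * (2 - z) := by
        gcongr
        have := mul_le_mul_of_nonneg_left hβ hz0.le
        linarith
      linarith
  · set E := Real.exp ((s - a₁) / 2) with hE
    have hE1 : 1 ≤ E := Real.one_le_exp (by linarith)
    refine lintegral_ofReal_le_of_ae_le (H := fun x => Real.exp θ * (2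
      + z * (E * Real.exp (Real.log (f₁ x / f₀ x) / 2)))) (fun x => by positivity)
      (((integrable_const _).add ((hexp.const_mul _).const_mul _)).const_mul _) ?_ ?_
    · filter_upwards [ae_sent_top hf₀ ht] with x hx
      rw [sent_policy, if_pos hs.le, update_of_le hs.le, llrCensored_of_true hx]
      simp only [sent, hx, if_true, mul_one]
      exact mul_le_mul_of_nonneg_left (superSol_le_two_add ha₁ hz0.le _ _) (Real.exp_pos _).le
    · rw [integral_const_mul, integral_add (integrable_const _) ((hexp.const_mul _).const_mul _),
        integral_const_mul, integral_const_mul, ← hβdef]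
      simp only [integral_const, probReal_univ, one_smul]
      have hVs : superSol a₁ z s = 2 + z * E := by rw [superSol, if_neg (not_le.2 hs)]
      -- `hθ2` is the case `E = 1`; larger `E` only helps, since `1 - exp θ * β` is nonnegative.
      have h1 : Real.exp θ * (2 + z * (E * β)) ≤ 2 + z * E := by
        have h2 : 0 ≤ z * (1 - Real.exp θ * β) := by linarith
        nlinarith [mul_le_mul_of_nonneg_left hE1 h2]
      nlinarith [mul_nonneg hη (zero_le_one.trans hV1)]

/-- One-step inequality for the probability of never exceeding `a₁`. -/
lemma le_lintegral_subSol {g c : ℝ} (hg0 : 0 < g) (hg : ∫ x, dropFraction f₀ f₁ a₁ x ∂(law f₀) = g)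
    (hc : c = 1 / (1 + g)) (hκ : 0 ≤ 1 - (e + -Real.log (1 - e) / (g * a₁))) (s : ℝ) :
    ENNReal.ofReal (1 - (e + -Real.log (1 - e) / (g * a₁))) * ENNReal.ofReal (subSol a₁ c s)
      ≤ ∫⁻ x, (if s ≤ a₁ then 1 else 0) *
          ENNReal.ofReal (subSol a₁ c (update f₀ f₁ a₁ ψtop ψlow s x)) ∂(law f₀) := by
  have := hf₀.isProbabilityMeasure_law
  set B := -Real.log (1 - e) with hB
  have hB0 : 0 ≤ B := by
    have := Real.log_nonpos (by linarith : 0 ≤ 1 - e) (by linarith)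
    linarith
  have hc0 : 0 ≤ c := by rw [hc]; positivity
  have hcg : c * g = 1 - c := by rw [hc]; field_simp; ring
  have hc1 : c ≤ 1 := by nlinarith
  rw [← ENNReal.ofReal_mul hκ]
  rcases lt_trichotomy s a₁ with hs | hs | hs
  · have hsi := integrable_sent hf₀ hl.1
    simp only [if_pos hs.le, one_mul]
    -- Transmitting paths are discarded, which costs the factor `1 - e`.
    refine le_lintegral_ofReal_of_ae_le
      (H := fun x => (1 - sent ψlow x) * (subSol a₁ c s - c * (B / a₁)))
      (((integrable_const _).sub hsi).mul_const _) (ae_of_all _ fun x => ?_) ?_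
    · rw [update_of_lt hs]
      have hcap : min a₁ (max 0 (s + llrCensored f₀ f₁ ψlow x)) ≤ a₁ := min_le_left _ _
      cases hx : ψlow x
      · have h1 := max_min_div_le ha₁ (s := s) hB0 (llrCensored_le_of_false hf₀ hf₁ hl he0.le he1 hx)
        simp only [sent, hx, Bool.false_eq_true, if_false, sub_zero, one_mul]
        rw [subSol, if_pos hs.le, subSol, if_pos hcap]
        linarith [mul_le_mul_of_nonneg_left h1 hc0]
      · simp only [sent, hx, if_true, sub_self, zero_mul]
        exact subSol_nonneg ha₁ hc0 hc1 _
    · rw [integral_mul_const, integral_sub (integrable_const _) hsi, integral_sent hl]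
      simp only [integral_const, probReal_univ, one_smul]
      -- Since `c = (1 - c) / g` and `subSol` is at least `1 - c` up to `a₁`, the additive loss
      -- becomes a multiplicative one.
      have h1 : c * (B / a₁) ≤ B / (g * a₁) * subSol a₁ c s := by
        have h2 := mul_le_mul_of_nonneg_left (le_subSol ha₁ hc0 hs.le)
          (show 0 ≤ B / (g * a₁) by positivity)
        have h3 : B / (g * a₁) * (c * g) = c * (B / a₁) := by field_simp
        rw [← hcg, h3] at h2
        exact h2
      have h4 : 0 ≤ e * (c * (B / a₁)) := by positivity
      nlinarith
  · simp only [if_pos hs.le, one_mul]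
    refine le_lintegral_ofReal_of_ae_le (H := fun x => c * dropFraction f₀ f₁ a₁ x)
      ((integrable_dropFraction hf₀ hf₁ ha₁).const_mul _) ?_ ?_
    · filter_upwards [ae_sent_top hf₀ ht] with x hx
      rw [update_of_le hs.ge, llrCensored_of_true hx, hs]
      exact subSol_boundary_ge ha₁ hc0 hc1 _
    · rw [integral_const_mul, hg, hcg]
      have hVa : subSol a₁ c s = 1 - c := by
        rw [subSol, if_pos hs.le, hs, max_eq_right ha₁.le, div_self ha₁.ne', mul_one]
      rw [hVa]
      have h5 : 0 ≤ e + B / (g * a₁) := by positivity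
      nlinarith [mul_nonneg h5 (sub_nonneg.2 hc1)]
  · rw [subSol, if_neg (not_le.2 hs), mul_zero, ENNReal.ofReal_zero]
    exact zero_le

end OneStep

/-! ### The communication rate -/

/-- Both inequalities are strict at `θ = 0`, so they persist for small `θ > 0`. -/
lemma exists_exponent {β g : ℝ} (hβ : β < 1) (hg : 0 < g) :
    ∃ θ : ℝ, 0 < θ ∧ Real.exp θ * (2 - g / 2) ≤ 2 ∧
      2 * (Real.exp θ - 1) ≤ g / 2 * (1 - Real.exp θ * β) := by
  have h1 : ∀ᶠ θ in nhds (0 : ℝ), Real.exp θ * (2 - g / 2) < 2 := by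
    refine ContinuousAt.eventually_lt (by fun_prop) continuousAt_const ?_
    rw [Real.exp_zero]
    linarith
  have h2 : ∀ᶠ θ in nhds (0 : ℝ),
      2 * (Real.exp θ - 1) < g / 2 * (1 - Real.exp θ * β) := by
    refine ContinuousAt.eventually_lt (by fun_prop) (by fun_prop) ?_
    rw [Real.exp_zero, sub_self, mul_zero, one_mul]
    exact mul_pos (by positivity) (by linarith)
  obtain ⟨θ, ⟨h3, h4⟩, h5⟩ := (((h1.and h2).filter_mono nhdsWithin_le_nhds).and
    (self_mem_nhdsWithin (s := Set.Ioi (0 : ℝ)))).exists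
  exact ⟨θ, h5, h3.le, h4.le⟩

/-- At `e = 0` the inequality reads `1 < exp (θ ε)`; continuity in `e` does the rest. -/
lemma exists_transmission_bound {θ g a₁ ε : ℝ} (hθ : 0 < θ) (hε : 0 < ε) :
    ∃ δ : ℝ, 0 < δ ∧ δ < 1 ∧ ∀ e : ℝ, 0 < e → e ≤ δ →
      1 + (-Real.log (1 - e) / a₁ + 2 * Real.exp θ * e)
        ≤ Real.exp (θ * ε) * (1 - (e + -Real.log (1 - e) / (g * a₁))) := by
  have hlog : ContinuousAt (fun e : ℝ => Real.log (1 - e)) 0 :=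
    ContinuousAt.log (by fun_prop) (by norm_num)
  have h : ∀ᶠ e in nhds (0 : ℝ), 1 + (-Real.log (1 - e) / a₁ + 2 * Real.exp θ * e)
      < Real.exp (θ * ε) * (1 - (e + -Real.log (1 - e) / (g * a₁))) := by
    refine ContinuousAt.eventually_lt ?_ ?_ ?_
    · exact continuousAt_const.add ((hlog.neg.div_const _).add (by fun_prop))
    · exact continuousAt_const.mul (continuousAt_const.sub
        (continuousAt_id.add (hlog.neg.div_const _)))
    · simpa using mul_pos hθ hε
  obtain ⟨r, hr, hball⟩ := Metric.eventually_nhds_iff.1 h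
  refine ⟨min (r / 2) (1 / 2), by positivity, ?_, fun e he0 he => (hball ?_).le⟩
  · exact (min_le_right _ _).trans_lt (by norm_num)
  · rw [Real.dist_eq, sub_zero, abs_of_pos he0]
    linarith [he.trans (min_le_left _ _)]

lemma subset_survival {Ω : Type*} (X : ℕ → Ω → ℝ) (f₀ f₁ : ℝ → ℝ) (a₁ : ℝ)
    (ψtop ψlow : Strategy) {a : EReal} (ha : (a₁ : EReal) < a) (n : ℕ) :
    {ω | ∀ j < n, stat f₀ f₁ a₁ ψtop ψlow (fun k => X k ω) j ≤ a₁}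
      ⊆ survival X f₀ f₁ a₁ ψtop ψlow a n := by
  intro ω hω
  change (n : ℕ∞) ≤ stopTime f₀ f₁ a₁ ψtop ψlow a fun k => X k ω
  refine le_iInf₂ fun k hk => ?_
  by_contra hlt
  have hkn : k < n := by exact_mod_cast not_le.1 hlt
  exact absurd (hk.trans (EReal.coe_le_coe_iff.2 (hω k hkn))) (not_le.2 ha)

/-- Exponential Chebyshev bound for a conditional mean: if the exponential moment of `S` is at most
`exp (θ b)` times the probability of the conditioning event, then the conditional mean of `S` is at
most `b`. -/
lemma integral_cond_le {Ω : Type*} [MeasurableSpace Ω] (P : Measure Ω) [IsProbabilityMeasure P]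
    {A : Set Ω} (hA : P A ≠ 0) {S : Ω → ℝ} (hS : Measurable S) {K : ℝ} (hS0 : ∀ ω, 0 ≤ S ω)
    (hSK : ∀ ω, S ω ≤ K) {θ b : ℝ} (hθ : 0 < θ)
    (h : ∫⁻ ω, ENNReal.ofReal (Real.exp (θ * S ω)) ∂P ≤ ENNReal.ofReal (Real.exp (θ * b)) * P A) :
    ∫ ω, S ω ∂(ProbabilityTheory.cond P A) ≤ b := by
  have hprob := cond_isProbabilityMeasure (μ := P) hA
  set Q := ProbabilityTheory.cond P A with hQ
  have hSi : Integrable S Q := (integrable_const K).mono' hS.aestronglyMeasurable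
    (ae_of_all _ fun ω => by rw [Real.norm_of_nonneg (hS0 ω)]; exact hSK ω)
  have hei : Integrable (fun ω => Real.exp (θ * S ω)) Q := by
    refine (integrable_const (Real.exp (θ * K))).mono'
      (hS.const_mul θ).exp.aestronglyMeasurable (ae_of_all _ fun ω => ?_)
    rw [Real.norm_of_nonneg (Real.exp_pos _).le]
    gcongr
    exact hSK ω
  have hle : ∫⁻ ω, ENNReal.ofReal (Real.exp (θ * S ω)) ∂Q ≤ ENNReal.ofReal (Real.exp (θ * b)) := by
    rw [hQ, ProbabilityTheory.cond, lintegral_smul_measure, smul_eq_mul]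
    calc (P A)⁻¹ * ∫⁻ ω in A, ENNReal.ofReal (Real.exp (θ * S ω)) ∂P
        ≤ (P A)⁻¹ * (ENNReal.ofReal (Real.exp (θ * b)) * P A) := by
          gcongr
          exact (setLIntegral_le_lintegral _ _).trans h
      _ = ENNReal.ofReal (Real.exp (θ * b)) * ((P A)⁻¹ * P A) := by ring
      _ = ENNReal.ofReal (Real.exp (θ * b)) := by
          rw [ENNReal.inv_mul_cancel hA (measure_ne_top _ _), mul_one]
  rw [← ofReal_integral_eq_lintegral_ofReal hei (ae_of_all _ fun ω => (Real.exp_pos _).le),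
    ENNReal.ofReal_le_ofReal_iff (Real.exp_pos _).le] at hle
  -- The tangent line of the exponential at `θ b`, integrated.
  have hjensen : Real.exp (θ * b) * (1 + θ * (∫ ω, S ω ∂Q - b))
      ≤ ∫ ω, Real.exp (θ * S ω) ∂Q := by
    have hsub : Integrable (fun ω => θ * (S ω - b)) Q :=
      (hSi.sub (integrable_const _)).const_mul _
    have hlin : Integrable (fun ω => Real.exp (θ * b) * (1 + θ * (S ω - b))) Q :=
      ((integrable_const _).add hsub).const_mul _
    calc Real.exp (θ * b) * (1 + θ * (∫ ω, S ω ∂Q - b))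
        = ∫ ω, Real.exp (θ * b) * (1 + θ * (S ω - b)) ∂Q := by
          rw [integral_const_mul, integral_add (integrable_const _) hsub, integral_const_mul,
            integral_sub hSi (integrable_const _)]
          simp
      _ ≤ ∫ ω, Real.exp (θ * S ω) ∂Q := by
          refine integral_mono hlin hei fun ω => ?_
          have h1 : θ * S ω = θ * b + θ * (S ω - b) := by ring
          simp only
          rw [h1, Real.exp_add]
          gcongr
          linarith [Real.add_one_le_exp (θ * (S ω - b))]
  have h2 : 1 + θ * (∫ ω, S ω ∂Q - b) ≤ 1 := by
    have := hjensen.trans hle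
    exact le_of_mul_le_mul_left (by linarith) (Real.exp_pos (θ * b))
  by_contra hlt
  have := mul_pos hθ (sub_pos.2 (not_le.1 hlt))
  linarith

/-! ### Exponential moments of the transmissions and survival probability -/

section Rate

variable {f₀ f₁ : ℝ → ℝ} (hf₀ : IsDensity f₀) (hf₁ : IsDensity f₁)
  {Ω : Type*} [MeasurableSpace Ω] {P : Measure Ω} [IsProbabilityMeasure P]
  {X : ℕ → Ω → ℝ} (hX_meas : ∀ k, Measurable (X k)) (hX_indep : iIndepFun X P)
  (hX_law : ∀ k, P.map (X k) = law f₀) {a₁ e : ℝ} (ha₁ : 0 < a₁)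
  (he0 : 0 < e) (he1 : e < 1) {ψtop ψlow : Strategy} (ht : ψtop ∈ strategyClass f₀ 1)
  (hl : ψlow ∈ strategyClass f₀ e)

include hf₀ hf₁ hX_meas ht hl

lemma measurable_stat (k : ℕ) :
    Measurable fun ω => stat f₀ f₁ a₁ ψtop ψlow (fun j => X j ω) k :=
  (measurable_chain (X := X) (σ := fun k ω => stat f₀ f₁ a₁ ψtop ψlow (fun j => X j ω) k)
    (fun _ => rfl) (fun _ _ => rfl) (measurable_update hf₀ hf₁ a₁ ht.1 hl.1) k).mono
    (past_le hX_meas k) le_rfl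

lemma measurable_gamma (k : ℕ) :
    Measurable fun ω => gamma f₀ f₁ a₁ ψtop ψlow (fun j => X j ω) k :=
  (measurable_sent_policy a₁ ht.1 hl.1).comp
    ((measurable_stat hf₀ hf₁ hX_meas ht hl k).prodMk (hX_meas k))

include hX_indep hX_law ha₁ he0 he1

lemma lintegral_exp_sum_gamma_le (h10 : law f₁ ≪ law f₀) (h01 : law f₀ ≪ law f₁) {θ g : ℝ}
    (hθ : 0 ≤ θ) (hg0 : 0 < g) (hg : ∫ x, dropFraction f₀ f₁ a₁ x ∂(law f₀) = g)
    (hβ : ∫ x, Real.exp (Real.log (f₁ x / f₀ x) / 2) ∂(law f₀) ≤ 1)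
    (hθ1 : Real.exp θ * (2 - g / 2) ≤ 2)
    (hθ2 : 2 * (Real.exp θ - 1) ≤ g / 2 *
      (1 - Real.exp θ * ∫ x, Real.exp (Real.log (f₁ x / f₀ x) / 2) ∂(law f₀))) (n : ℕ) :
    ∫⁻ ω, ENNReal.ofReal (Real.exp
        (θ * ∑ k ∈ Finset.range n, gamma f₀ f₁ a₁ ψtop ψlow (fun j => X j ω) k)) ∂P
      ≤ ENNReal.ofReal (1 + (-Real.log (1 - e) / a₁ + 2 * Real.exp θ * e)) ^ n := by
  have := hf₀.isProbabilityMeasure_law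
  have hmain := lintegral_prod_weight_le hX_meas hX_indep hX_law
    (σ := fun k ω => stat f₀ f₁ a₁ ψtop ψlow (fun j => X j ω) k) (s₀ := 0)
    (fun _ => rfl) (fun _ _ => rfl) (measurable_update hf₀ hf₁ a₁ ht.1 hl.1)
    (w := fun s x => ENNReal.ofReal (Real.exp (θ * sent (policy a₁ ψtop ψlow s) x)))
    ((measurable_sent_policy a₁ ht.1 hl.1).const_mul θ).exp.ennreal_ofReal
    (V := fun s => ENNReal.ofReal (superSol a₁ (g / 2) s))
    (measurable_superSol a₁ (g / 2)).ennreal_ofReal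
    (lintegral_superSol_le hf₀ hf₁ ha₁ he0 he1 ht hl h10 h01 hθ hg0 hg hβ hθ1 hθ2) n
  rw [superSol_zero ha₁, ENNReal.ofReal_one, mul_one] at hmain
  refine le_trans (lintegral_mono fun ω => ?_) hmain
  rw [Finset.mul_sum, Real.exp_sum, ENNReal.ofReal_prod_of_nonneg fun _ _ => (Real.exp_pos _).le]
  refine le_mul_of_one_le_right zero_le ?_
  exact ENNReal.one_le_ofReal.2 (one_le_superSol ha₁ (by positivity) _)

lemma le_measure_survival {g : ℝ} (hg0 : 0 < g)
    (hg : ∫ x, dropFraction f₀ f₁ a₁ x ∂(law f₀) = g)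
    (hκ : 0 ≤ 1 - (e + -Real.log (1 - e) / (g * a₁))) {a : EReal} (ha : (a₁ : EReal) < a)
    (n : ℕ) : ENNReal.ofReal (1 - (e + -Real.log (1 - e) / (g * a₁))) ^ n
      ≤ P (survival X f₀ f₁ a₁ ψtop ψlow a n) := by
  have := hf₀.isProbabilityMeasure_law
  have hc0 : 0 ≤ 1 / (1 + g) := by positivity
  have hmain := le_lintegral_prod_weight hX_meas hX_indep hX_law
    (σ := fun k ω => stat f₀ f₁ a₁ ψtop ψlow (fun j => X j ω) k) (s₀ := 0)
    (fun _ => rfl) (fun _ _ => rfl) (measurable_update hf₀ hf₁ a₁ ht.1 hl.1)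
    (w := fun s _ => if s ≤ a₁ then 1 else 0)
    (Measurable.ite (measurableSet_le measurable_fst measurable_const) measurable_const
      measurable_const)
    (V := fun s => ENNReal.ofReal (subSol a₁ (1 / (1 + g)) s))
    (measurable_subSol a₁ _).ennreal_ofReal
    (le_lintegral_subSol hf₀ hf₁ ha₁ he0 he1 ht hl hg0 hg rfl hκ) n
  rw [subSol_zero ha₁, ENNReal.ofReal_one, mul_one] at hmain
  refine hmain.trans (le_trans ?_ (measure_mono (subset_survival X f₀ f₁ a₁ ψtop ψlow ha n)))
  refine le_trans (lintegral_mono fun ω => ?_) (lintegral_indicator_one_le _)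
  -- As `subSol ≤ 1`, it can be dropped; the product of the weights is the indicator of never
  -- exceeding `a₁` before time `n`.
  refine (mul_le_of_le_one_right zero_le
    (ENNReal.ofReal_le_one.2 (subSol_le_one ha₁ hc0 _))).trans ?_
  by_cases hω : ∀ j < n, stat f₀ f₁ a₁ ψtop ψlow (fun k => X k ω) j ≤ a₁
  · rw [Set.indicator_of_mem (Set.mem_ofPred.2 hω)]
    refine Finset.prod_le_one' fun j _ => ?_
    split_ifs <;> simp
  · obtain ⟨j, hj, hja⟩ : ∃ j < n, ¬ stat f₀ f₁ a₁ ψtop ψlow (fun k => X k ω) j ≤ a₁ := by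
      simpa using hω
    rw [Finset.prod_eq_zero (Finset.mem_range.2 hj) (if_neg hja)]
    exact zero_le

end Rate

end CuSumAC

end

theorem lemma1
    (f₀ f₁ : ℝ → ℝ) (hf₀ : CuSumAC.IsDensity f₀) (hf₁ : CuSumAC.IsDensity f₁)
    (hI₁₀_pos : 0 < InformationTheory.klDiv (CuSumAC.law f₁) (CuSumAC.law f₀))
    (hI₁₀_fin : InformationTheory.klDiv (CuSumAC.law f₁) (CuSumAC.law f₀) < ⊤)
    (hI₀₁_pos : 0 < InformationTheory.klDiv (CuSumAC.law f₀) (CuSumAC.law f₁))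
    (hI₀₁_fin : InformationTheory.klDiv (CuSumAC.law f₀) (CuSumAC.law f₁) < ⊤)
    {Ω : Type*} [MeasurableSpace Ω] (P : Measure Ω) [IsProbabilityMeasure P]
    (X : ℕ → Ω → ℝ) (hX_meas : ∀ k, Measurable (X k)) (hX_indep : iIndepFun X P)
    (hX_law : ∀ k, P.map (X k) = CuSumAC.law f₀)
    (a₁ ε : ℝ) (ha₁ : 0 < a₁) (hε_pos : 0 < ε) (hε_le : ε ≤ 1) :
    ∃ E : Set ℝ, E ⊆ Set.Ioc 0 1 ∧ E.Nonempty ∧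
      (∃ ψtop, CuSumAC.IsOptimal f₀ f₁ 1 ψtop) ∧
      ∀ ε₁ ∈ E,
        (∃ ψlow, CuSumAC.IsOptimal f₀ f₁ ε₁ ψlow) ∧
        ∀ ψtop ψlow : CuSumAC.Strategy,
          CuSumAC.IsOptimal f₀ f₁ 1 ψtop → CuSumAC.IsOptimal f₀ f₁ ε₁ ψlow →
          ∀ a : EReal, (a₁ : EReal) < a →
            (∀ n : ℕ, 0 < P (CuSumAC.survival X f₀ f₁ a₁ ψtop ψlow a n)) ∧
            CuSumAC.commRate P X f₀ f₁ a₁ ψtop ψlow a ≤ ε := by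
  open CuSumAC in
  have := hf₀.isProbabilityMeasure_law
  have := hf₁.isProbabilityMeasure_law
  obtain ⟨h10, hllr⟩ := InformationTheory.klDiv_ne_top_iff.1 hI₁₀_fin.ne
  obtain ⟨h01, -⟩ := InformationTheory.klDiv_ne_top_iff.1 hI₀₁_fin.ne
  have hne : law f₁ ≠ law f₀ := fun h => by
    rw [h, InformationTheory.klDiv_self] at hI₁₀_pos
    exact lt_irrefl _ hI₁₀_pos
  have hLi := integrable_log_ratio hf₀ hf₁ h10 hllr
  have hβ := integral_exp_half_lt_one hf₀ hf₁ h10 h01 hne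
  obtain ⟨g, hg⟩ : ∃ g, ∫ x, dropFraction f₀ f₁ a₁ x ∂(law f₀) = g := ⟨_, rfl⟩
  have hg0 : 0 < g := hg ▸ integral_min_neg_log_pos hf₀ hf₁ h10 h01 hne ha₁
  obtain ⟨θ, hθ, hθ1, hθ2⟩ := exists_exponent hβ hg0
  obtain ⟨δ, hδ0, hδ1, hδ⟩ :=
    exists_transmission_bound (θ := θ) (g := g) (a₁ := a₁) (ε := ε) hθ hε_pos
  -- `δ` is fixed before the threshold and the maximizers are introduced.
  refine ⟨Set.Ioc 0 δ, Set.Ioc_subset_Ioc_right hδ1.le, ⟨δ, hδ0, le_rfl⟩,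
    exists_isOptimal_one hf₀ h10, fun e he => ?_⟩
  have he1 : e < 1 := he.2.trans_lt hδ1
  refine ⟨exists_isOptimal hf₀ hf₁ h10 h01 hLi he.1 he1, fun ψtop ψlow htop hlow a ha => ?_⟩
  have hη : 0 < 1 + (-Real.log (1 - e) / a₁ + 2 * Real.exp θ * e) := by
    have h1 := Real.log_nonpos (by linarith : 0 ≤ 1 - e) (by linarith [he.1])
    have h2 : 0 ≤ -Real.log (1 - e) / a₁ := div_nonneg (by linarith) ha₁.le
    have h3 : 0 ≤ 2 * Real.exp θ * e := mul_nonneg (by positivity) he.1.le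
    linarith
  have hcmp := hδ e he.1 he.2
  have hκ : 0 < 1 - (e + -Real.log (1 - e) / (g * a₁)) :=
    pos_of_mul_pos_right (hη.trans_le hcmp) (Real.exp_pos _).le
  have hsurv := le_measure_survival hf₀ hf₁ hX_meas hX_indep hX_law ha₁ he.1 he1 htop.1 hlow.1
    hg0 hg hκ.le ha
  have hpos : ∀ n : ℕ, 0 < P (survival X f₀ f₁ a₁ ψtop ψlow a n) := fun n =>
    lt_of_lt_of_le (ENNReal.pow_pos (ENNReal.ofReal_pos.2 hκ) n) (hsurv n)
  refine ⟨hpos, ?_⟩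
  have hsum_nonneg : ∀ (n : ℕ) (ω : Ω),
      0 ≤ ∑ k ∈ Finset.range n, gamma f₀ f₁ a₁ ψtop ψlow (fun j => X j ω) k := fun n ω =>
    Finset.sum_nonneg fun k _ => sent_nonneg _ _
  have hsum_le : ∀ (n : ℕ) (ω : Ω),
      ∑ k ∈ Finset.range n, gamma f₀ f₁ a₁ ψtop ψlow (fun j => X j ω) k ≤ n := fun n ω => by
    refine (Finset.sum_le_card_nsmul _ _ 1 fun k _ => sent_le_one _ _).trans ?_
    simp
  have hmean : ∀ n : ℕ, ∫ ω, ∑ k ∈ Finset.range n, gamma f₀ f₁ a₁ ψtop ψlow (fun j => X j ω) k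
      ∂(ProbabilityTheory.cond P (survival X f₀ f₁ a₁ ψtop ψlow a n)) ≤ n * ε := by
    intro n
    refine integral_cond_le P (hpos n).ne' (Finset.measurable_fun_sum _ fun k _ =>
      measurable_gamma hf₀ hf₁ hX_meas htop.1 hlow.1 k) (hsum_nonneg n) (hsum_le n) hθ ?_
    calc _ ≤ ENNReal.ofReal (1 + (-Real.log (1 - e) / a₁ + 2 * Real.exp θ * e)) ^ n :=
          lintegral_exp_sum_gamma_le hf₀ hf₁ hX_meas hX_indep hX_law ha₁ he.1 he1 htop.1 hlow.1
            h10 h01 hθ.le hg0 hg hβ.le hθ1 hθ2 n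
      _ ≤ ENNReal.ofReal (Real.exp (θ * ε)
            * (1 - (e + -Real.log (1 - e) / (g * a₁)))) ^ n := by gcongr
      _ = ENNReal.ofReal (Real.exp (θ * (n * ε)))
            * ENNReal.ofReal (1 - (e + -Real.log (1 - e) / (g * a₁))) ^ n := by
          rw [ENNReal.ofReal_mul (Real.exp_pos _).le, mul_pow,
            ← ENNReal.ofReal_pow (Real.exp_pos _).le, ← Real.exp_nat_mul]
          congr 3
          ring
      _ ≤ _ := by
          gcongr
          exact hsurv n
  -- The real `limsup` needs a lower bound on the sequence, here `0`; the term `n = 0` is `0` since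
  -- `1 / 0 = 0`.
  refine limsup_le_of_le (isCoboundedUnder_le_of_le atTop (x := 0) fun n => ?_)
    (Eventually.of_forall fun n => ?_)
  · exact mul_nonneg (by positivity) (integral_nonneg (hsum_nonneg n))
  · rcases Nat.eq_zero_or_pos n with rfl | hn
    · simpa using hε_pos.le
    · have hn' : (0 : ℝ) < n := Nat.cast_pos.2 hn
      rw [one_div, inv_mul_le_iff₀ hn']
      exact hmean n
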